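/- Fix $\alpha>0$, $C>0$ and $\sigma>0$. For $\beta>0$ and $L>0$ let $\text{H\"older}^{\beta}(L)$ be the set of functions $h:\mathbb R\to\mathbb R$ that are $k$ times differentiable and satisfy $|h^{(k)}(t)-h^{(k)}(t')|\le L|t-t'|^{\beta-k}$ for all $t,t'\in\mathbb R$, where $k=k(\beta)$; here either $k(\beta)=\lfloor\beta\rfloor$ for all $\beta$, or $k(\beta)$ is the largest integer strictly smaller than $\beta$ for all $\beta$ (with this second convention $\text{H\"older}^{1}(1)$ is the set of $1$-Lipschitz functions). The result holds with either convention. Let $$H^\alpha(C)=\{f_h : h\in \text{H\"older}^{\alpha}(C)\cap\text{H\"older}^{1}(1)\},\qquad f_h(t_1,t_2)=\mathbf 1_{\{t_2<h(t_1)\}},\quad (t_1,t_2)\in[0,1]^2 .$$ For $n\ge1$ and $0\le i,j\le n-1$ let $x_{i,j}$ be the average of $f$ over the pixel $[\frac in,\frac{i+1}n)\times[\frac jn,\frac{j+1}n)$, and let $y_{i,j}=x_{i,j}+z_{i,j}$ with $z_{i,j}$ i.i.d. $N(0,\sigma^2)$. Extend $y$ to $\mathbb Z^2$ periodically with period $n$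 in each index. For an absolutely summable $g:\mathbb Z^2\to\mathbb R$ with $\sum_{m,\ell}g_{m,\ell}=1$ let $$\hat f^{LF}_g(i,j)=\sum_{m,\ell\in\mathbb Z}g_{m,\ell}\,y_{i-m,j-\ell},\qquad R_n(f,\hat f^{LF}_g)=\mathbb E\Big(\frac1{n^2}\sum_{i,j=0}^{n-1}\big(x_{i,j}-\hat f^{LF}_g(i,j)\big)^2\Big),\qquad \hat G(\omega_1,\omega_2)=\sum_{m,\ell}g_{m,\ell}e^{-\mathrm i(m\omega_1+\ell\omega_2)} .$$ Let $\mathcal G$ be the set of all such filters $g$ that are symmetric ($g_{i,j}=g_{-i,j}=g_{i,-j}$ for all $i,j$), isotropic (there is $F:\mathbb R\to\mathbb C$ with $\hat G(\omega_1,\omega_2)=F(\sqrt{\omega_1^2+\omega_2^2})$ for all $-\pi<\omega_1,\omega_2\le\pi$), and whose Fourier transform $\hat G$ is differentiable with bounded gradient: $\sup_{\omega}\|\operatorname{grad}\hat G(\omega)\|_2<\infty$ (the bound may depend on $g$). Then $$\inf_{g\in\mathcal G}\ \sup_{f\in H^\alpha(C)}R_n(f,\hat f^{LF}_g)\asymp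 n^{-2/3}\qquad(n\to\infty),$$ that is, there are constants $c_1,c_2>0$ and $n_0$, depending only on $\alpha$, $C$, $\sigma$ and the convention for $k$, such that for all $n>n_0$ the left-hand side lies between $c_1n^{-2/3}$ and $c_2n^{-2/3}$. -/

import Mathlib

open MeasureTheory ProbabilityTheory
open scoped NNReal ENNReal

noncomputable section

namespace HorizonFilter

/-! ### Horizon images -/

/-- Contours that are `k` times differentiable on `ℝ` and whose `k`-th derivative is Hölder of
exponent `α - k` with constant `C`. -/
def HolderClass (k : ℕ) (α C : ℝ) : Set (ℝ → ℝ) :=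
  {h | (∀ l < k, Differentiable ℝ (iteratedDeriv l h)) ∧
    ∀ t t' : ℝ, |iteratedDeriv k h t - iteratedDeriv k h t'| ≤ C * |t - t'| ^ (α - k)}

/-- The image `f_h(t₁, t₂) = 1` if `t₂ < h(t₁)`, and `0` otherwise.
Only its values on the unit square are ever used. -/
def horizonImage (h : ℝ → ℝ) : ℝ × ℝ → ℝ :=
  Set.indicator {t : ℝ × ℝ | t.2 < h t.1} (fun _ => 1)

/-- The Horizon class `H^α(C)`: contours in `Hölder^α(C) ∩ Hölder^1(1)`. The function `ord`
gives the order of the derivative that occurs in the definition of the Hölder class of a given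
smoothness. -/
def horizonClass (ord : ℝ → ℕ) (α C : ℝ) : Set (ℝ × ℝ → ℝ) :=
  {f | ∃ h : ℝ → ℝ, h ∈ HolderClass (ord α) α C ∩ HolderClass (ord 1) 1 1 ∧ f = horizonImage h}

/-! ### Pixels

The pixels of an `n × n` image are indexed by `ZMod n × ZMod n`, with representatives
`0, …, n - 1`; shifting an index in `ZMod n` is the periodic extension of the image. -/

/-- `Pixel(i,j) = [i/n, (i+1)/n) × [j/n, (j+1)/n)`. -/
def pixel (n : ℕ) (i j : ZMod n) : Set (ℝ × ℝ) :=
  Set.Ico ((i.val : ℝ) / n) (((i.val : ℝ) + 1) / n) ×ˢ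
    Set.Ico ((j.val : ℝ) / n) (((j.val : ℝ) + 1) / n)

/-- The pixel averages `x_{i,j}` of `f`. -/
def pixelAverage (n : ℕ) (f : ℝ × ℝ → ℝ) (i j : ZMod n) : ℝ :=
  ⨍ t in pixel n i j, f t

/-! ### Linear convolution filters -/

/-- The filter output `∑ₘ ∑ₗ g_{m,l} y_{i-m,j-l}`, with `y` extended periodically. -/
def linearFilter (g : ℤ → ℤ → ℝ) {n : ℕ} (y : ZMod n → ZMod n → ℝ) (i j : ZMod n) : ℝ :=
  ∑' p : ℤ × ℤ, g p.1 p.2 * y (i - (p.1 : ZMod n)) (j - (p.2 : ZMod n))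

/-- The two-dimensional Fourier transform `Ĝ(ω₁, ω₂)` of the impulse response `g`. -/
def fourierTransform (g : ℤ → ℤ → ℝ) (ω₁ ω₂ : ℝ) : ℂ :=
  ∑' p : ℤ × ℤ, (g p.1 p.2 : ℂ) *
    Complex.exp (-Complex.I * ((p.1 : ℂ) * (ω₁ : ℂ) + (p.2 : ℂ) * (ω₂ : ℂ)))

/-- The Euclidean norm of the gradient of `Ĝ` at `(ω₁, ω₂)`. -/
def gradNorm (g : ℤ → ℤ → ℝ) (ω₁ ω₂ : ℝ) : ℝ :=
  Real.sqrt (‖deriv (fun t => fourierTransform g t ω₂) ω₁‖ ^ 2 +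
    ‖deriv (fun t => fourierTransform g ω₁ t) ω₂‖ ^ 2)

/-- The filters under consideration: real impulse responses, absolutely summable with total
weight one, symmetric, isotropic, and with a Fourier transform of bounded gradient. -/
structure IsAdmissible (g : ℤ → ℤ → ℝ) : Prop where
  hasSum_one : HasSum (fun p : ℤ × ℤ => g p.1 p.2) 1
  symm_fst : ∀ i j, g (-i) j = g i j
  symm_snd : ∀ i j, g i (-j) = g i j
  isotropic : ∃ F : ℝ → ℂ, ∀ ω₁ ω₂ : ℝ,
    -Real.pi < ω₁ → ω₁ ≤ Real.pi → -Real.pi < ω₂ → ω₂ ≤ Real.pi →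
      fourierTransform g ω₁ ω₂ = F (Real.sqrt (ω₁ ^ 2 + ω₂ ^ 2))
  differentiable : Differentiable ℝ (fun ω : ℝ × ℝ => fourierTransform g ω.1 ω.2)
  bounded_grad : ∃ D : ℝ, ∀ ω₁ ω₂ : ℝ, gradNorm g ω₁ ω₂ ≤ D

/-! ### Risk -/

/-- The law of the noise: independent `N(0, σ²)` variables, one for each pixel. -/
def noiseLaw (σ : ℝ≥0) (n : ℕ) [NeZero n] : Measure (ZMod n × ZMod n → ℝ) :=
  Measure.pi (fun _ => gaussianReal 0 (σ ^ 2))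

/-- The risk `E (n⁻² ∑ᵢ ∑ⱼ (x_{i,j} - f̂_{i,j})²)` of the linear filter `g` at the image `f`, where
the data are `y_{i,j} = x_{i,j} + z_{i,j}`. -/
def risk (σ : ℝ≥0) (n : ℕ) [NeZero n] (f : ℝ × ℝ → ℝ) (g : ℤ → ℤ → ℝ) : ℝ≥0∞ :=
  ∫⁻ z, ENNReal.ofReal (1 / (n : ℝ) ^ 2 * ∑ i : ZMod n, ∑ j : ZMod n,
    (pixelAverage n f i j -
      linearFilter g (fun a b => pixelAverage n f a b + z (a, b)) i j) ^ 2) ∂(noiseLaw σ n)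

/-- The best worst-case risk of the admissible linear filters over the Horizon class. -/
def minimaxRisk (ord : ℝ → ℕ) (α C : ℝ) (σ : ℝ≥0) (n : ℕ) [NeZero n] : ℝ≥0∞ :=
  ⨅ (g : ℤ → ℤ → ℝ) (_ : IsAdmissible g), ⨆ f ∈ horizonClass ord α C, risk σ n f g

end HorizonFilter

end

noncomputable section

namespace HorizonFilter

/-! ### The risk as squared bias plus variance -/

/-! The risk is squared bias plus a variance that does not depend on the image (`risk_eq`), and both
bounds come from balancing these two terms.

Lower bound. On the discrete torus the filter multiplies Fourier coefficients by some `G`. At each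
frequency it loses the fraction `|1 - G|²` of the energy of the image and lets through the fraction
`|G|²` of the noise (`sum_freq_le_bias_add_variance`), and `G` cannot be close to both 1 and 0. A
straight edge of slope `s` has Fourier coefficients of order at least `n² / k₂` where `k₁ ≈ s k₂`
(`norm_torusDFT_edge_ge`). One filter must serve all slopes. Take `16 M + 1` slopes whose directions
sweep a block of order `M²` frequencies with `k₂` of order `M`. In the sum of the risks over the
slopes, each frequency costs at least a constant times `min (M⁻²) (M σ² / n²)`. Hence some slope has
risk at least of order `M * min (M⁻²) (M σ² / n²)`, and `M ≈ n^(2/3)` gives `n^(-2/3)`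
(`exists_slope_risk_ge`).

Upper bound. Average over a window of about `N` pixels with a kernel of total mass 1. The variance
is of order `N⁻²`. A horizon image has total variation `O(n)` on the torus, so its `ℓ¹` distance to
a shift by `p` is `O(n |p|)`. The bias is bounded and has `ℓ¹` norm `O(n N)`, so the mean squared
bias is `O(N / n)` (`risk_le_of_localized`). Then `N ≈ n^(1/3)` gives `n^(-2/3)`. For exact isotropy
on the whole frequency square, the kernel consists of lattice samples of the Fourier transform of a
smooth radial bump supported well inside that square. By Poisson summation without aliasing, its
transfer function is the bump itself (`fourierTransform_lowPass`). -/

theorem integral_sq_affine_gaussian {ι : Type*} [Fintype ι] (v : ℝ≥0) (b : ℝ) (c : ι → ℝ) :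
    Integrable (fun z : ι → ℝ => (b - ∑ a, c a * z a) ^ 2)
        (Measure.pi fun _ : ι => gaussianReal 0 v) ∧
      ∫ z, (b - ∑ a, c a * z a) ^ 2 ∂(Measure.pi fun _ : ι => gaussianReal 0 v) =
        b ^ 2 + v * ∑ a, c a ^ 2 := by
  set μ : Measure (ι → ℝ) := Measure.pi fun _ : ι => gaussianReal 0 v
  have hid : MemLp (fun x : ℝ => x) 2 (gaussianReal 0 v) :=
    memLp_id_gaussianReal' 2 (by simp)
  have hcoord : ∀ a, MemLp (fun z : ι → ℝ => c a * z a) 2 μ := fun a =>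
    (hid.comp_measurePreserving (measurePreserving_eval (fun _ : ι => gaussianReal 0 v) a)).const_mul
      (c a)
  have hsum : MemLp (fun z : ι → ℝ => ∑ a, c a * z a) 2 μ :=
    memLp_finsetSum _ fun a _ => hcoord a
  have hY : MemLp (fun z : ι → ℝ => b - ∑ a, c a * z a) 2 μ := (memLp_const b).sub hsum
  have hmean_coord : ∀ a, ∫ z : ι → ℝ, z a ∂μ = 0 := by
    intro a
    have h := integral_map (μ := μ) (φ := fun z : ι → ℝ => z a) (f := fun x : ℝ => x)
      (measurable_pi_apply a).aemeasurable (by fun_prop)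
    rw [← h, (measurePreserving_eval (fun _ : ι => gaussianReal 0 v) a).map_eq]
    exact integral_id_gaussianReal
  have hmean_sum : ∫ z, ∑ a, c a * z a ∂μ = 0 := by
    rw [integral_finsetSum _ fun a _ => (hcoord a).integrable (by norm_num)]
    exact Finset.sum_eq_zero fun a _ => by rw [integral_const_mul, hmean_coord, mul_zero]
  have hmean : ∫ z, (b - ∑ a, c a * z a) ∂μ = b := by
    rw [integral_sub (integrable_const b) (hsum.integrable (by norm_num)), hmean_sum]
    simp
  have hvar : variance (fun z : ι → ℝ => b - ∑ a, c a * z a) μ = v * ∑ a, c a ^ 2 := by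
    rw [variance_const_sub hsum.aestronglyMeasurable]
    have h := variance_sum_pi (μ := fun _ : ι => gaussianReal 0 v) (X := fun a x => c a * x)
      (fun a => hid.const_mul (c a))
    have hfun : (fun z : ι → ℝ => ∑ a, c a * z a) = ∑ a, fun z : ι → ℝ => c a * z a := by
      ext z; simp
    rw [hfun, h, Finset.mul_sum]
    refine Finset.sum_congr rfl fun a _ => ?_
    rw [variance_const_mul, variance_fun_id_gaussianReal]
    ring
  refine ⟨hY.integrable_sq, ?_⟩
  have h := variance_eq_sub hY
  rw [hvar, hmean] at h
  simp only [Pi.pow_apply] at h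
  linarith

/-- Group the terms of the series by the fibres of `r`. With `r = reduce n` this turns a filter on
`ℤ × ℤ` into a convolution on the finite torus. -/
theorem tsum_mul_comp_eq_sum {P ι 𝕜 : Type*} [Fintype ι] [DecidableEq ι] [RCLike 𝕜]
    {G : P → 𝕜} (hG : Summable G) (r : P → ι) (u : ι → 𝕜) :
    ∑' p, G p * u (r p) = ∑ c, (∑' p, if r p = c then G p else 0) * u c := by
  have hs : ∀ c, Summable fun p => if r p = c then G p else 0 := fun c => by
    refine (hG.indicator {p | r p = c}).congr fun p => ?_
    simp [Set.indicator_apply]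
  simp_rw [← tsum_mul_right]
  rw [← Summable.tsum_finsetSum fun c _ => (hs c).mul_right (u c)]
  refine tsum_congr fun p => ?_
  simp

/-- Reduction of an integer index modulo `n`. -/
def reduce (n : ℕ) (p : ℤ × ℤ) : ZMod n × ZMod n := ((p.1 : ZMod n), (p.2 : ZMod n))

/-- The filter on the discrete torus induced by an impulse response on `ℤ × ℤ`. -/
def periodize (g : ℤ → ℤ → ℝ) (n : ℕ) (c : ZMod n × ZMod n) : ℝ :=
  ∑' p : ℤ × ℤ, if reduce n p = c then g p.1 p.2 else 0

theorem linearFilter_eq_sum {g : ℤ → ℤ → ℝ} (hg : Summable fun p : ℤ × ℤ => g p.1 p.2) {n : ℕ}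
    [NeZero n] (y : ZMod n → ZMod n → ℝ) (i j : ZMod n) :
    linearFilter g y i j = ∑ c, periodize g n c * y (i - c.1) (j - c.2) :=
  tsum_mul_comp_eq_sum hg (reduce n) fun c => y (i - c.1) (j - c.2)

/-- The error of the filter on noiseless data. -/
def bias (g : ℤ → ℤ → ℝ) {n : ℕ} (x : ZMod n → ZMod n → ℝ) (i j : ZMod n) : ℝ :=
  x i j - linearFilter g x i j

/-- At each pixel the error is the bias minus a linear form in the noise. Its coefficients are a
reflected translate of `periodize g n`, so every pixel has the same variance. -/
theorem risk_eq {g : ℤ → ℤ → ℝ} (hg : Summable fun p : ℤ × ℤ => g p.1 p.2) (σ : ℝ≥0) (n : ℕ)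
    [NeZero n] (f : ℝ × ℝ → ℝ) :
    risk σ n f g = ENNReal.ofReal (1 / (n : ℝ) ^ 2 *
      ∑ i : ZMod n, ∑ j : ZMod n, bias g (pixelAverage n f) i j ^ 2 +
        (σ : ℝ) ^ 2 * ∑ c, periodize g n c ^ 2) := by
  have hn : (n : ℝ) ≠ 0 := NeZero.ne _
  have herr : ∀ (z : ZMod n × ZMod n → ℝ) (i j : ZMod n), pixelAverage n f i j -
      linearFilter g (fun a b => pixelAverage n f a b + z (a, b)) i j =
      bias g (pixelAverage n f) i j - ∑ a, periodize g n ((i, j) - a) * z a := by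
    intro z i j
    rw [bias, linearFilter_eq_sum hg, linearFilter_eq_sum hg]
    have : ∑ a, periodize g n ((i, j) - a) * z a =
        ∑ c : ZMod n × ZMod n, periodize g n c * z (i - c.1, j - c.2) := by
      rw [← Equiv.sum_comp (Equiv.subLeft ((i, j) : ZMod n × ZMod n))]
      simp only [Equiv.subLeft_apply, sub_sub_cancel]
      rfl
    rw [this, sub_sub, ← Finset.sum_add_distrib]
    simp_rw [mul_add]
  have hint := fun i j : ZMod n => integral_sq_affine_gaussian (σ ^ 2)
    (bias g (pixelAverage n f) i j) fun a : ZMod n × ZMod n => periodize g n ((i, j) - a)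
  unfold risk
  simp_rw [herr]
  unfold noiseLaw
  rw [← ofReal_integral_eq_lintegral_ofReal]
  · rw [integral_const_mul, integral_finsetSum _ fun i _ =>
      integrable_finsetSum _ fun j _ => (hint i j).1]
    simp_rw [integral_finsetSum _ fun j _ => (hint _ j).1, (hint _ _).2]
    have hper : ∀ i j : ZMod n, ∑ a, periodize g n ((i, j) - a) ^ 2 = ∑ c, periodize g n c ^ 2 :=
      fun i j => Equiv.sum_comp (Equiv.subLeft ((i, j) : ZMod n × ZMod n))
        fun c => periodize g n c ^ 2
    simp_rw [hper, Finset.sum_add_distrib]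
    simp only [Finset.sum_const, Finset.card_univ, ZMod.card, nsmul_eq_mul]
    congr 1
    push_cast
    field_simp
  · exact (integrable_finsetSum _ fun i _ =>
      integrable_finsetSum _ fun j _ => (hint i j).1).const_mul _
  · exact Filter.Eventually.of_forall fun z => by positivity

/-! ### Cell averages -/

/-- The half-open unit square. -/
def unitCell : Set (ℝ × ℝ) := Set.Ico 0 1 ×ˢ Set.Ico 0 1

/-- The part of the rescaled cell `(i, j)` of the grid of mesh `1 / n` that lies under the
graph of `h`. -/
def subgraphCell (h : ℝ → ℝ) (n : ℕ) (i j : ℤ) : Set (ℝ × ℝ) :=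
  {u | u ∈ unitCell ∧ (j + u.2) / n < h ((i + u.1) / n)}

/-- The fraction of the cell `(i, j)` of the grid of mesh `1 / n` that lies under the graph
of `h`. -/
def cellAverage (h : ℝ → ℝ) (n : ℕ) (i j : ℤ) : ℝ := volume.real (subgraphCell h n i j)

theorem volume_unitCell : volume unitCell = 1 := by
  rw [unitCell, Measure.volume_eq_prod, Measure.prod_prod]
  simp

theorem cellAverage_mono {h : ℝ → ℝ} {n : ℕ} {i j i' j' : ℤ}
    (H : ∀ u ∈ unitCell, (j + u.2) / n < h ((i + u.1) / n) →
      (j' + u.2) / n < h ((i' + u.1) / n)) :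
    cellAverage h n i j ≤ cellAverage h n i' j' :=
  measureReal_mono (fun u hu => ⟨hu.1, H u hu.1 hu.2⟩)
    ((measure_mono fun _ hu => hu.1).trans_lt (volume_unitCell.trans_lt ENNReal.one_lt_top)).ne

theorem cellAverage_nonneg (h : ℝ → ℝ) (n : ℕ) (i j : ℤ) : 0 ≤ cellAverage h n i j :=
  measureReal_nonneg

theorem cellAverage_le_one (h : ℝ → ℝ) (n : ℕ) (i j : ℤ) : cellAverage h n i j ≤ 1 := by
  have h1 : volume.real unitCell = 1 := by simp [measureReal_def, volume_unitCell]
  rw [← h1]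
  exact measureReal_mono (fun u hu => hu.1) (by simp [volume_unitCell])

theorem cellAverage_eq_one {h : ℝ → ℝ} {n : ℕ} {i j : ℤ}
    (H : ∀ u ∈ unitCell, (j + u.2) / n < h ((i + u.1) / n)) : cellAverage h n i j = 1 := by
  have : subgraphCell h n i j = unitCell := Set.ext fun u => ⟨fun hu => hu.1, fun hu => ⟨hu, H u hu⟩⟩
  simp [cellAverage, this, measureReal_def, volume_unitCell]

theorem cellAverage_eq_zero {h : ℝ → ℝ} {n : ℕ} {i j : ℤ}
    (H : ∀ u ∈ unitCell, h ((i + u.1) / n) ≤ (j + u.2) / n) : cellAverage h n i j = 0 := by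
  have : subgraphCell h n i j = ∅ :=
    Set.eq_empty_of_forall_notMem fun u hu => (H u hu.1).not_gt hu.2
  simp [cellAverage, this]

theorem cellAverage_antitone_snd (h : ℝ → ℝ) (n : ℕ) (i : ℤ) :
    Antitone fun j => cellAverage h n i j := by
  intro j j' hj
  refine cellAverage_mono fun u _ hu => lt_of_le_of_lt ?_ hu
  have : (j : ℝ) ≤ j' := by exact_mod_cast hj
  gcongr

theorem cellAverage_monotone_fst {h : ℝ → ℝ} (hh : Monotone h) (n : ℕ) (j : ℤ) :
    Monotone fun i => cellAverage h n i j := by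
  intro i i' hi
  refine cellAverage_mono fun u _ hu => hu.trans_le (hh ?_)
  have : (i : ℝ) ≤ i' := by exact_mod_cast hi
  gcongr

theorem cellAverage_antitone_fst {h : ℝ → ℝ} (hh : Antitone h) (n : ℕ) (j : ℤ) :
    Antitone fun i => cellAverage h n i j := by
  intro i i' hi
  refine cellAverage_mono fun u _ hu => hu.trans_le (hh ?_)
  have : (i : ℝ) ≤ i' := by exact_mod_cast hi
  gcongr

theorem volume_preimage_rescale {n : ℕ} (hn : n ≠ 0) (c : ℝ × ℝ) (s : Set (ℝ × ℝ)) :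
    volume.real ((fun t : ℝ × ℝ => (n : ℝ) • t) ⁻¹' ((fun t => t - c) ⁻¹' s)) =
      ((n : ℝ) ^ 2)⁻¹ * volume.real s := by
  have hn' : (n : ℝ) ≠ 0 := by exact_mod_cast hn
  simp_rw [sub_eq_add_neg]
  rw [measureReal_def, Measure.addHaar_preimage_smul _ hn', measure_preimage_add_right,
    ENNReal.toReal_mul, ENNReal.toReal_ofReal (abs_nonneg _), measureReal_def]
  simp

/-- The map `t ↦ n t - (i, j)` carries the pixel onto the unit cell. Integer indices also allow
cells outside the unit square, which occur when rows are compared after a vertical shift. -/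
theorem pixelAverage_horizonImage {h : ℝ → ℝ} (hh : Continuous h) {n : ℕ} [NeZero n]
    (i j : ZMod n) :
    pixelAverage n (horizonImage h) i j = cellAverage h n i.val j.val := by
  have hn : (0 : ℝ) < n := by exact_mod_cast Nat.pos_of_neZero n
  set c : ℝ × ℝ := ((i.val : ℝ), (j.val : ℝ)) with hc
  have hpix : pixel n i j =
      (fun t : ℝ × ℝ => (n : ℝ) • t) ⁻¹' ((fun t => t - c) ⁻¹' unitCell) := by
    ext t
    simp only [pixel, unitCell, hc, Set.mem_prod, Set.mem_Ico, Set.mem_preimage, Prod.fst_sub,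
      Prod.snd_sub, Prod.smul_fst, Prod.smul_snd, smul_eq_mul, div_le_iff₀ hn, lt_div_iff₀ hn]
    constructor <;> rintro ⟨⟨h1, h2⟩, h3, h4⟩ <;> refine ⟨⟨?_, ?_⟩, ?_, ?_⟩ <;> linarith
  have hsub : pixel n i j ∩ {t : ℝ × ℝ | t.2 < h t.1} =
      (fun t : ℝ × ℝ => (n : ℝ) • t) ⁻¹' ((fun t => t - c) ⁻¹'
        subgraphCell h n i.val j.val) := by
    rw [hpix]
    ext t
    have h1 : (((i.val : ℤ) : ℝ) + ((n : ℝ) * t.1 - (i.val : ℝ))) / n = t.1 := by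
      push_cast; field_simp; ring
    have h2 : (((j.val : ℤ) : ℝ) + ((n : ℝ) * t.2 - (j.val : ℝ))) / n = t.2 := by
      push_cast; field_simp; ring
    simp only [Set.mem_inter_iff, Set.mem_preimage, Set.mem_ofPred_eq, subgraphCell, hc,
      Prod.fst_sub, Prod.snd_sub, Prod.smul_fst, Prod.smul_snd, smul_eq_mul, h1, h2]
  have hmeas : MeasurableSet {t : ℝ × ℝ | t.2 < h t.1} :=
    (isOpen_lt continuous_snd (hh.comp continuous_fst)).measurableSet
  rw [pixelAverage, setAverage_eq, horizonImage, setIntegral_indicator hmeas, hsub, hpix,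
    volume_preimage_rescale (NeZero.ne n)]
  simp only [integral_const, smul_eq_mul, mul_one, measureReal_restrict_apply MeasurableSet.univ,
    Set.univ_inter]
  rw [volume_preimage_rescale (NeZero.ne n), measureReal_def, volume_unitCell, cellAverage]
  simp only [ENNReal.toReal_one]
  field_simp

/-! ### The discrete Fourier transform on the torus -/

open ZMod (stdAddChar)

/-- The (unnormalized) Fourier coefficients of a function on the discrete torus. -/
def torusDFT {n : ℕ} [NeZero n] (u : ZMod n × ZMod n → ℝ) (k : ZMod n × ZMod n) : ℂ :=
  ∑ a, (u a : ℂ) * stdAddChar (-(k.1 * a.1 + k.2 * a.2))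

theorem sum_stdAddChar_torus {n : ℕ} [NeZero n] (k : ZMod n × ZMod n) :
    ∑ a : ZMod n × ZMod n, (stdAddChar (k.1 * a.1 + k.2 * a.2) : ℂ) =
      if k = 0 then (n : ℂ) ^ 2 else 0 := by
  have h := fun b : ZMod n => AddChar.sum_mulShift b (ZMod.isPrimitive_stdAddChar n)
  simp_rw [AddChar.map_add_eq_mul]
  rw [Fintype.sum_prod_type]
  simp_rw [← Finset.mul_sum, ← Finset.sum_mul, mul_comm k.1, mul_comm k.2, h, ZMod.card]
  rcases k with ⟨k₁, k₂⟩
  by_cases h1 : k₁ = 0 <;> by_cases h2 : k₂ = 0 <;> simp [h1, h2, sq]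

/-- Bessel's inequality for the characters divided by `n`, which are orthonormal. -/
theorem sum_sq_torusDFT_le {n : ℕ} [NeZero n] (u : ZMod n × ZMod n → ℝ)
    (S : Finset (ZMod n × ZMod n)) :
    ∑ k ∈ S, ‖torusDFT u k‖ ^ 2 ≤ (n : ℝ) ^ 2 * ∑ a, u a ^ 2 := by
  have hn : (n : ℂ) ≠ 0 := NeZero.ne _
  have hn' : (0 : ℝ) < n := by exact_mod_cast Nat.pos_of_neZero n
  let v : ZMod n × ZMod n → EuclideanSpace ℂ (ZMod n × ZMod n) := fun k =>
    WithLp.toLp 2 fun a => (n : ℂ)⁻¹ * stdAddChar (k.1 * a.1 + k.2 * a.2)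
  have hv : Orthonormal ℂ v := by
    rw [orthonormal_iff_ite]
    intro k l
    have : inner ℂ (v k) (v l) = ((n : ℂ) ^ 2)⁻¹ * ∑ a : ZMod n × ZMod n,
        (stdAddChar ((l - k).1 * a.1 + (l - k).2 * a.2) : ℂ) := by
      rw [PiLp.inner_apply, Finset.mul_sum]
      refine Finset.sum_congr rfl fun a _ => ?_
      have h : (l - k).1 * a.1 + (l - k).2 * a.2 =
          (l.1 * a.1 + l.2 * a.2) + -(k.1 * a.1 + k.2 * a.2) := by
        simp only [Prod.fst_sub, Prod.snd_sub]; ring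
      rw [h, AddChar.map_add_eq_mul, AddChar.map_neg_eq_conj]
      simp only [v, RCLike.inner_apply, map_mul, map_inv₀, map_natCast]
      ring
    rw [this, sum_stdAddChar_torus]
    by_cases h : k = l
    · simp [h, hn]
    · simp [h, sub_eq_zero, Ne.symm h]
  have hinner : ∀ k, inner ℂ (v k) (WithLp.toLp 2 fun a => (u a : ℂ)) =
      (n : ℂ)⁻¹ * torusDFT u k := by
    intro k
    rw [PiLp.inner_apply, torusDFT, Finset.mul_sum]
    refine Finset.sum_congr rfl fun a _ => ?_
    rw [AddChar.map_neg_eq_conj]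
    simp only [v, RCLike.inner_apply, map_mul, map_inv₀, map_natCast]
    ring
  have h := hv.sum_inner_products_le (s := S) (WithLp.toLp 2 fun a => (u a : ℂ))
  simp_rw [hinner, EuclideanSpace.norm_sq_eq, norm_mul, mul_pow, ← Finset.mul_sum] at h
  simp only [norm_inv, Complex.norm_natCast, Complex.norm_real, Real.norm_eq_abs, sq_abs] at h
  rw [inv_pow, inv_mul_le_iff₀ (by positivity)] at h
  exact h

theorem torusDFT_convolution {n : ℕ} [NeZero n] (p u : ZMod n × ZMod n → ℝ)
    (k : ZMod n × ZMod n) :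
    torusDFT (fun a => ∑ c, p c * u (a - c)) k = torusDFT p k * torusDFT u k := by
  simp only [torusDFT]
  rw [Finset.sum_mul_sum]
  push_cast
  simp_rw [Finset.sum_mul]
  rw [Finset.sum_comm]
  refine Finset.sum_congr rfl fun c _ => ?_
  rw [← Equiv.sum_comp (Equiv.addRight c)]
  refine Finset.sum_congr rfl fun a _ => ?_
  have h : -(k.1 * (a + c).1 + k.2 * (a + c).2) =
      -(k.1 * c.1 + k.2 * c.2) + -(k.1 * a.1 + k.2 * a.2) := by
    simp only [Prod.fst_add, Prod.snd_add]; ring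
  simp only [Equiv.coe_addRight, add_sub_cancel_right]
  rw [h, AddChar.map_add_eq_mul]
  ring

/-- The Fourier coefficients of the bias are those of the image times `1 - G`, with `G` the
transform of the periodized filter. Bessel's inequality is applied to the bias and to the filter. -/
theorem sum_freq_le_bias_add_variance {g : ℤ → ℤ → ℝ}
    (hg : Summable fun p : ℤ × ℤ => g p.1 p.2) (σ : ℝ) {n : ℕ} [NeZero n]
    (x : ZMod n → ZMod n → ℝ) (S : Finset (ZMod n × ZMod n)) :
    ∑ k ∈ S, (‖1 - torusDFT (periodize g n) k‖ ^ 2 *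
        (‖torusDFT (fun a => x a.1 a.2) k‖ ^ 2 / (n : ℝ) ^ 4) +
        σ ^ 2 / (n : ℝ) ^ 2 * ‖torusDFT (periodize g n) k‖ ^ 2) ≤
      1 / (n : ℝ) ^ 2 * ∑ i : ZMod n, ∑ j : ZMod n, bias g x i j ^ 2 +
        σ ^ 2 * ∑ c, periodize g n c ^ 2 := by
  have hn : (0 : ℝ) < n := by exact_mod_cast Nat.pos_of_neZero n
  have hbias : ∀ k, torusDFT (fun a => bias g x a.1 a.2) k =
      (1 - torusDFT (periodize g n) k) * torusDFT (fun a => x a.1 a.2) k := by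
    intro k
    have h := torusDFT_convolution (periodize g n) (fun a => x a.1 a.2) k
    rw [sub_mul, one_mul, ← h]
    simp only [torusDFT]
    rw [← Finset.sum_sub_distrib]
    refine Finset.sum_congr rfl fun a _ => ?_
    rw [bias, linearFilter_eq_sum hg]
    simp only [Prod.fst_sub, Prod.snd_sub]
    push_cast
    ring
  have h1 := sum_sq_torusDFT_le (fun a : ZMod n × ZMod n => bias g x a.1 a.2) S
  have h2 := sum_sq_torusDFT_le (periodize g n) S
  simp_rw [hbias, norm_mul, mul_pow] at h1
  rw [Fintype.sum_prod_type] at h1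
  rw [Finset.sum_add_distrib, ← Finset.mul_sum]
  simp_rw [← mul_div_assoc]
  rw [← Finset.sum_div]
  refine add_le_add ?_ ?_
  · rw [div_le_iff₀ (by positivity)]
    refine h1.trans (le_of_eq ?_)
    field_simp
  · rw [div_mul_eq_mul_div, div_le_iff₀ (by positivity), mul_assoc]
    exact mul_le_mul_of_nonneg_left (h2.trans (le_of_eq (mul_comm _ _))) (sq_nonneg _)

/-! ### Fourier coefficients of a straight edge -/

theorem val_sub_one_of_ne_zero {n : ℕ} [NeZero n] (hn : 1 < n) {b : ZMod n} (hb : b ≠ 0) :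
    (b - 1).val = b.val - 1 := by
  have : Fact (1 < n) := ⟨hn⟩
  have h1 : (1 : ZMod n).val = 1 := ZMod.val_one n
  rw [ZMod.val_sub, h1]
  rw [h1]
  exact Nat.one_le_iff_ne_zero.2 ((ZMod.val_ne_zero b).2 hb)

/-- Summation by parts in the second index replaces the image by its vertical drops: nonnegative
weights of mass 1 in each column, located within 2 cells of the edge. When `k₁ ≈ s k₂` the character
has nearly constant phase along the edge, so the `n` unit masses do not cancel. The factor from
summation by parts is at most `2 π k₂ / n`. -/
theorem norm_torusDFT_edge_ge {h : ℝ → ℝ} {s : ℝ} (hs0 : 0 ≤ s) (hs1 : s ≤ 1 / 4)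
    (hh : ∀ t ∈ Set.Icc (0 : ℝ) 1, h t = 1 / 2 - s * t) {n : ℕ} [NeZero n] {k₁ k₂ : ℕ}
    (hk₁ : 0 < k₁) (hk₁n : k₁ < n) (hk₂ : 0 < k₂) (hk₂n : 48 * k₂ ≤ n)
    (hk : |(k₁ : ℝ) - s * k₂| ≤ 1 / 8) :
    (n : ℝ) ^ 2 ≤ 4 * Real.pi * k₂ *
      ‖torusDFT (fun a : ZMod n × ZMod n => cellAverage h n a.1.val a.2.val)
        ((k₁ : ZMod n), (k₂ : ZMod n))‖ := by
  have hn48 : 48 ≤ n := by omega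
  have hn : (48 : ℝ) ≤ n := by exact_mod_cast hn48
  have hn0 : (0 : ℝ) < n := by linarith
  set x : ZMod n → ZMod n → ℝ := fun a b => cellAverage h n a.val b.val with hx
  set E : ZMod n → ZMod n → ℂ := fun a b =>
    stdAddChar (-((k₁ : ZMod n) * a + (k₂ : ZMod n) * b)) with hE
  have hcell : ∀ (a : ZMod n) (u : ℝ × ℝ), u ∈ unitCell →
      h ((((a.val : ℕ) : ℤ) + u.1) / n) = 1 / 2 - s * ((a.val + u.1) / n) := by
    rintro a u ⟨⟨hu1, hu2⟩, -⟩
    have ha : (a.val : ℝ) + 1 ≤ n := by exact_mod_cast ZMod.val_lt a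
    rw [hh]
    · push_cast; rfl
    · push_cast
      exact ⟨by positivity, (div_le_one hn0).2 (by linarith)⟩
  have hzero : ∀ a, x a 0 = 1 := by
    intro a
    refine cellAverage_eq_one fun u hu => ?_
    rw [hcell a u hu]
    obtain ⟨⟨hu1, hu2⟩, hu3, hu4⟩ := hu
    have ha : (a.val : ℝ) + 1 ≤ n := by exact_mod_cast ZMod.val_lt a
    have h1 : (a.val + u.1) / n ≤ 1 := (div_le_one hn0).2 (by linarith)
    have h0 : 0 ≤ (a.val + u.1) / n := by positivity
    rw [ZMod.val_zero, div_lt_iff₀ hn0]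
    push_cast
    have h2 : s * ((a.val + u.1) / n) ≤ 1 / 4 * 1 := mul_le_mul hs1 h1 h0 (by norm_num)
    nlinarith
  have hlast : ∀ a, x a (0 - 1) = 0 := by
    intro a
    refine cellAverage_eq_zero fun u hu => ?_
    rw [hcell a u hu]
    obtain ⟨⟨hu1, hu2⟩, hu3, hu4⟩ := hu
    have h0 : 0 ≤ (a.val + u.1) / n := by positivity
    have hv : ((0 - 1 : ZMod n).val : ℝ) = n - 1 := by
      obtain ⟨m, rfl⟩ : ∃ m, n = m + 1 := ⟨n - 1, by omega⟩
      rw [zero_sub, ZMod.val_neg_one]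
      push_cast; ring
    push_cast
    rw [hv, le_div_iff₀ hn0]
    nlinarith [mul_nonneg hs0 h0]
  -- The slope bound `s ≤ 1 / 4` keeps the edge away from the top and bottom rows, so the periodic
  -- extension jumps from 0 to 1 at `b = 0`. That jump is split off and treated in `hrow`.
  set d : ZMod n → ZMod n → ℝ := fun a b => if b = 0 then 0 else x a (b - 1) - x a b with hd
  have hdiff : ∀ a b, x a b - x a (b - 1) = (if b = 0 then 1 else 0) - d a b := by
    intro a b
    by_cases hb : b = 0
    · simp only [hd, hb, if_true, hzero, hlast]
    · simp only [hd, hb, if_false]; ring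
  have hd0 : ∀ a b, 0 ≤ d a b := by
    intro a b
    by_cases hb : b = 0
    · simp [hd, hb]
    · simp only [hd, hb, if_false, sub_nonneg]
      refine cellAverage_antitone_snd h n _ ?_
      rw [val_sub_one_of_ne_zero (by omega) hb]
      omega
  have hdsum : ∀ a, ∑ b, d a b = 1 := by
    intro a
    have h1 : ∑ b, (x a b - x a (b - 1)) = 0 := by
      rw [Finset.sum_sub_distrib, sub_eq_zero]
      exact (Equiv.sum_comp (Equiv.subRight (1 : ZMod n)) (x a)).symm
    simp_rw [hdiff, Finset.sum_sub_distrib] at h1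
    simp only [Finset.sum_ite_eq', Finset.mem_univ, if_true] at h1
    linarith
  have hsupp : ∀ a b, d a b ≠ 0 → |(b.val : ℝ) - (n / 2 - s * a.val)| ≤ 2 := by
    intro a b hab
    by_contra hlt
    apply hab
    by_cases hb : b = 0
    · simp [hd, hb]
    have hbv : 1 ≤ b.val := Nat.one_le_iff_ne_zero.2 ((ZMod.val_ne_zero b).2 hb)
    have hbm : (((b - 1).val : ℕ) : ℝ) = b.val - 1 := by
      rw [val_sub_one_of_ne_zero (by omega) hb]; push_cast [hbv]; ring
    simp only [hd, hb, if_false, hx]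
    have hmul : ∀ u : ℝ × ℝ, (1 / 2 - s * ((a.val + u.1) / n)) * n =
        n / 2 - s * a.val - s * u.1 := by
      intro u; field_simp; ring
    rcases lt_abs.1 (not_le.1 hlt) with hlt | hlt
    · rw [cellAverage_eq_zero, cellAverage_eq_zero, sub_zero]
      all_goals
        intro u hu
        rw [hcell a u hu, le_div_iff₀ hn0, hmul]
        obtain ⟨⟨hu1, hu2⟩, hu3, hu4⟩ := hu
        push_cast
        nlinarith
    · rw [cellAverage_eq_one, cellAverage_eq_one, sub_self]
      all_goals
        intro u hu
        rw [hcell a u hu, div_lt_iff₀ hn0, hmul]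
        obtain ⟨⟨hu1, hu2⟩, hu3, hu4⟩ := hu
        push_cast
        nlinarith
  have hEexp : ∀ a b, E a b =
      Complex.exp (-(2 * Real.pi * ((k₁ * a.val + k₂ * b.val) / n) : ℝ) * Complex.I) := by
    intro a b
    have h1 : -((k₁ : ZMod n) * a + (k₂ : ZMod n) * b) =
        ((-(k₁ * a.val + k₂ * b.val : ℤ) : ℤ) : ZMod n) := by
      push_cast; simp
    simp only [hE]
    rw [h1, ZMod.stdAddChar_coe]
    congr 1
    push_cast
    ring
  -- The factor `exp (i π k₂)` removes the constant phase coming from the height `n / 2` of the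
  -- edge.
  have hphase : ∀ a b, d a b ≠ 0 →
      1 / 2 ≤ (Complex.exp ((Real.pi * k₂ : ℝ) * Complex.I) * E a b).re := by
    intro a b hab
    have hb := hsupp a b hab
    rw [hEexp, ← Complex.exp_add]
    have h1 : ((Real.pi * k₂ : ℝ) : ℂ) * Complex.I +
        -((2 * Real.pi * ((k₁ * a.val + k₂ * b.val) / n) : ℝ) : ℂ) * Complex.I =
        ((-(2 * Real.pi * (((k₁ - s * k₂) * a.val +
          k₂ * (b.val - (n / 2 - s * a.val))) / n)) : ℝ) : ℂ) * Complex.I := by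
      rw [← neg_mul, ← add_mul]
      congr 1
      rw [← Complex.ofReal_neg, ← Complex.ofReal_add]
      congr 1
      field_simp
      ring
    rw [h1, Complex.exp_ofReal_mul_I_re, Real.cos_neg, ← Real.cos_abs, ← Real.cos_pi_div_three]
    have ha : (a.val : ℝ) ≤ n := by exact_mod_cast (ZMod.val_lt a).le
    have hk₂' : (48 : ℝ) * k₂ ≤ n := by exact_mod_cast hk₂n
    -- The direction error contributes `1 / 8` and the cell error at most `2 k₂ / n ≤ 1 / 24`. The
    -- sum `1 / 6` is an angle of at most `π / 3`, whose cosine is at least `1 / 2`.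
    have hbound : |((k₁ - s * k₂) * a.val + k₂ * (b.val - (n / 2 - s * a.val))) / (n : ℝ)| ≤
        1 / 6 := by
      rw [abs_div, abs_of_pos hn0, div_le_iff₀ hn0]
      refine (abs_add_le _ _).trans ?_
      rw [abs_mul, abs_mul, Nat.abs_cast, Nat.abs_cast]
      have e1 : |(k₁ : ℝ) - s * k₂| * a.val ≤ 1 / 8 * n := by gcongr
      have e2 : (k₂ : ℝ) * |(b.val : ℝ) - (n / 2 - s * a.val)| ≤ k₂ * 2 := by gcongr
      linarith
    refine Real.cos_le_cos_of_nonneg_of_le_pi (abs_nonneg _) (by linarith [Real.pi_pos]) ?_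
    rw [abs_mul, abs_of_pos Real.two_pi_pos]
    nlinarith [Real.pi_pos]
  set T := torusDFT (fun a : ZMod n × ZMod n => cellAverage h n a.1.val a.2.val)
        ((k₁ : ZMod n), (k₂ : ZMod n)) with hT
  have hTsum : T = ∑ a, ∑ b, (x a b : ℂ) * E a b := by
    rw [hT, torusDFT, Fintype.sum_prod_type]
  have hparts : T * (1 - stdAddChar (-(k₂ : ZMod n))) = -∑ a, ∑ b, (d a b : ℂ) * E a b := by
    have hshift : T * stdAddChar (-(k₂ : ZMod n)) =
        ∑ a, ∑ b, (x a (b - 1) : ℂ) * E a b := by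
      rw [hTsum, Finset.sum_mul]
      refine Finset.sum_congr rfl fun a _ => ?_
      rw [Finset.sum_mul, ← Equiv.sum_comp (Equiv.subRight (1 : ZMod n))]
      refine Finset.sum_congr rfl fun b _ => ?_
      simp only [Equiv.subRight_apply, hE]
      rw [mul_assoc, ← AddChar.map_add_eq_mul]
      congr 2
      ring
    -- The wrap-around jump fills a whole row, where the character is nontrivial because `0 < k₁ <
    -- n`.
    have hrow : ∑ a : ZMod n, ∑ b : ZMod n, ((if b = 0 then 1 else 0 : ℝ) : ℂ) * E a b = 0 := by
      have h1 := AddChar.sum_mulShift (-(k₁ : ZMod n)) (ZMod.isPrimitive_stdAddChar n)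
      have h2 : -(k₁ : ZMod n) ≠ 0 := by
        rw [neg_ne_zero, Ne, ZMod.natCast_eq_zero_iff]
        exact Nat.not_dvd_of_pos_of_lt hk₁ hk₁n
      rw [if_neg h2, Nat.cast_zero] at h1
      rw [← h1]
      refine Finset.sum_congr rfl fun a _ => ?_
      rw [Finset.sum_eq_single (0 : ZMod n) (by intro b _ hb; simp [hb]) (by simp)]
      simp only [if_true, hE]
      simp [mul_comm]
    rw [mul_sub, mul_one, hshift, hTsum, ← Finset.sum_sub_distrib]
    simp_rw [← Finset.sum_sub_distrib, ← sub_mul, ← Complex.ofReal_sub, hdiff]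
    simp_rw [Complex.ofReal_sub, sub_mul, Finset.sum_sub_distrib]
    rw [hrow, zero_sub]
  have hlow : (n : ℝ) / 2 ≤ ‖T * (1 - stdAddChar (-(k₂ : ZMod n)))‖ := by
    rw [hparts, norm_neg]
    have hz : ‖Complex.exp ((Real.pi * k₂ : ℝ) * Complex.I)‖ = 1 := Complex.norm_exp_ofReal_mul_I _
    rw [← one_mul ‖_‖, ← hz, ← norm_mul]
    refine le_trans ?_ (Complex.re_le_norm _)
    simp_rw [Finset.mul_sum, Complex.re_sum]
    have hterm : ∀ a b, d a b * (1 / 2) ≤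
        (Complex.exp ((Real.pi * k₂ : ℝ) * Complex.I) * ((d a b : ℂ) * E a b)).re := by
      intro a b
      rw [mul_left_comm, Complex.re_ofReal_mul]
      by_cases hab : d a b = 0
      · simp [hab]
      · exact mul_le_mul_of_nonneg_left (hphase a b hab) (hd0 a b)
    calc (n : ℝ) / 2 = ∑ a, ∑ b, d a b * (1 / 2) := by
          simp_rw [← Finset.sum_mul, hdsum]
          simp [ZMod.card]
          ring
      _ ≤ _ := Finset.sum_le_sum fun a _ => Finset.sum_le_sum fun b _ => hterm a b
  have hfac : ‖(1 : ℂ) - stdAddChar (-(k₂ : ZMod n))‖ ≤ 2 * Real.pi * k₂ / n := by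
    have h1 : -(k₂ : ZMod n) = ((-(k₂ : ℤ) : ℤ) : ZMod n) := by push_cast; rfl
    rw [h1, ZMod.stdAddChar_coe, norm_sub_rev]
    have h2 : 2 * (Real.pi : ℂ) * Complex.I * ((-(k₂ : ℤ) : ℤ) : ℂ) / n =
        Complex.I * ((-(2 * Real.pi * k₂ / n) : ℝ) : ℂ) := by
      push_cast; ring
    rw [h2]
    refine Real.norm_exp_I_mul_ofReal_sub_one_le.trans (le_of_eq ?_)
    rw [Real.norm_eq_abs, abs_neg, abs_of_nonneg (by positivity)]
  rw [norm_mul] at hlow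
  have h3 : (n : ℝ) / 2 ≤ ‖T‖ * (2 * Real.pi * k₂ / n) :=
    hlow.trans (mul_le_mul_of_nonneg_left hfac (norm_nonneg _))
  rw [← mul_div_assoc, le_div_iff₀ hn0] at h3
  nlinarith

/-! ### Nearly straight contours of every smoothness -/

open scoped ContDiff in
-- The Hölder condition is global on `ℝ`, while only `[0, 1]` is seen by the image. Cutting off the
-- identity keeps the contour straight there and bounds all derivatives, so small multiples lie in
-- every Hölder class needed.
theorem exists_smooth_ramp : ∃ ψ : ℝ → ℝ, ContDiff ℝ ∞ ψ ∧ HasCompactSupport ψ ∧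
    ∀ t ∈ Set.Icc (0 : ℝ) 1, ψ t = t := by
  let f : ContDiffBump (0 : ℝ) := ⟨1, 2, one_pos, one_lt_two⟩
  refine ⟨fun t => t * f t, contDiff_id.mul f.contDiff, f.hasCompactSupport.mul_left, ?_⟩
  intro t ht
  have : f t = 1 := f.one_of_mem_closedBall (by
    rw [mem_closedBall_zero_iff, Real.norm_eq_abs, abs_of_nonneg ht.1]; exact ht.2)
  simp [this]

theorem le_mul_rpow_of_le_of_le_mul {M d y β : ℝ} (hM : 0 ≤ M) (hd : 0 ≤ d) (hβ0 : 0 ≤ β)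
    (hβ1 : β ≤ 1) (h1 : y ≤ M) (h2 : y ≤ M * d) : y ≤ M * d ^ β := by
  rcases le_total d 1 with hd1 | hd1
  · refine h2.trans (mul_le_mul_of_nonneg_left ?_ hM)
    rcases hd.eq_or_lt with rfl | hd0
    · exact Real.rpow_nonneg le_rfl _
    · simpa using Real.rpow_le_rpow_of_exponent_ge hd0 hd1 hβ1
  · exact h1.trans (le_mul_of_one_le_right hM (Real.one_le_rpow hd1 hβ0))

open scoped ContDiff in
theorem exists_holder_bound_iteratedDeriv {ψ : ℝ → ℝ} (hψ : ContDiff ℝ ∞ ψ)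
    (hc : HasCompactSupport ψ) (k : ℕ) {β : ℝ} (hβ0 : 0 ≤ β) (hβ1 : β ≤ 1) :
    ∃ M : ℝ, 0 < M ∧ ∀ t t' : ℝ,
      |iteratedDeriv k ψ t - iteratedDeriv k ψ t'| ≤ M * |t - t'| ^ β := by
  have hcs : ∀ l, HasCompactSupport (iteratedDeriv l ψ) := by
    intro l
    induction l with
    | zero => simpa using hc
    | succ l ih => rw [iteratedDeriv_succ]; exact ih.deriv
  have hcont : ∀ l, Continuous (iteratedDeriv l ψ) := fun l =>
    hψ.continuous_iteratedDeriv l (by exact_mod_cast le_top)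
  have hdiff : ∀ l, Differentiable ℝ (iteratedDeriv l ψ) := fun l =>
    hψ.differentiable_iteratedDeriv l (by exact_mod_cast WithTop.coe_lt_top _)
  obtain ⟨A, hA⟩ := (hcont k).bounded_above_of_compact_support (hcs k)
  obtain ⟨B, hB⟩ := (hcont (k + 1)).bounded_above_of_compact_support (hcs (k + 1))
  have hA0 : 0 ≤ A := (norm_nonneg _).trans (hA 0)
  have hB0 : 0 ≤ B := (norm_nonneg _).trans (hB 0)
  refine ⟨2 * A + B + 1, by positivity, fun t t' => ?_⟩
  refine le_mul_rpow_of_le_of_le_mul (by positivity) (abs_nonneg _) hβ0 hβ1 ?_ ?_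
  · have h1 := hA t
    have h2 := hA t'
    rw [Real.norm_eq_abs] at h1 h2
    exact (abs_sub _ _).trans (by linarith)
  · have h := Convex.norm_image_sub_le_of_norm_deriv_le (f := iteratedDeriv k ψ) (s := Set.univ)
      (C := B) (fun x _ => hdiff k x)
      (fun x _ => by rw [← iteratedDeriv_succ]; exact hB x) convex_univ
      (Set.mem_univ t') (Set.mem_univ t)
    rw [Real.norm_eq_abs, Real.norm_eq_abs] at h
    exact h.trans (mul_le_mul_of_nonneg_right (by linarith) (abs_nonneg _))

open scoped ContDiff in
theorem exists_holderClass_of_smooth {ψ : ℝ → ℝ} (hψ : ContDiff ℝ ∞ ψ)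
    (hc : HasCompactSupport ψ) {k : ℕ} {α C : ℝ} (hC : 0 < C) (h0 : 0 ≤ α - k)
    (h1 : α - k ≤ 1) (b : ℝ) :
    ∃ s₀ : ℝ, 0 < s₀ ∧ ∀ s, 0 ≤ s → s ≤ s₀ → (fun t => b - s * ψ t) ∈ HolderClass k α C := by
  obtain ⟨M, hM, hbound⟩ := exists_holder_bound_iteratedDeriv hψ hc k h0 h1
  refine ⟨C / M, by positivity, fun s hs0 hs => ⟨fun l hl => ?_, fun t t' => ?_⟩⟩
  · have hsm : ContDiff ℝ ∞ fun t => b - s * ψ t := contDiff_const.sub (contDiff_const.mul hψ)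
    exact hsm.differentiable_iteratedDeriv l (by exact_mod_cast WithTop.coe_lt_top _)
  · have hder : ∀ t t', iteratedDeriv k (fun t => b - s * ψ t) t -
        iteratedDeriv k (fun t => b - s * ψ t) t' =
        -(s * (iteratedDeriv k ψ t - iteratedDeriv k ψ t')) := by
      intro t t'
      rcases Nat.eq_zero_or_pos k with rfl | hk
      · simp only [iteratedDeriv_zero]; ring
      · have hk' : ∀ t, iteratedDeriv k (fun t => b - s * ψ t) t = -(s * iteratedDeriv k ψ t) := by
          intro t
          rw [iteratedDeriv_const_sub hk, iteratedDeriv_neg, iteratedDeriv_const_mul_field]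
        rw [hk', hk']; ring
    rw [hder, abs_neg, abs_mul, abs_of_nonneg hs0]
    calc s * |iteratedDeriv k ψ t - iteratedDeriv k ψ t'|
        ≤ C / M * (M * |t - t'| ^ (α - k)) :=
          mul_le_mul hs (hbound t t') (abs_nonneg _) (by positivity)
      _ = C * |t - t'| ^ (α - k) := by field_simp

/-- The only property of the two conventions that the lower bound needs. -/
theorem sub_ord_mem_Icc {ord : ℝ → ℕ}
    (hord : ord = (fun a : ℝ => ⌊a⌋₊) ∨ ord = (fun a : ℝ => ⌈a⌉₊ - 1)) {a : ℝ} (ha : 0 < a) :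
    0 ≤ a - ord a ∧ a - ord a ≤ 1 := by
  rcases hord with rfl | rfl
  · have h1 := Nat.floor_le ha.le
    have h2 := Nat.lt_floor_add_one a
    constructor <;> linarith
  · have h0 : 1 ≤ ⌈a⌉₊ := Nat.one_le_ceil_iff.2 ha
    have h1 := Nat.le_ceil a
    have h2 := Nat.ceil_lt_add_one ha.le
    push_cast [h0]
    constructor <;> linarith

/-- The slope limit has the form `1 / E` with `E` a natural number so that `E * M` can serve as an
integer frequency. `E ≥ 4` gives the slope bound `1 / 4` of `norm_torusDFT_edge_ge`. -/
theorem exists_straight_contours {ord : ℝ → ℕ}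
    (hord : ord = (fun a : ℝ => ⌊a⌋₊) ∨ ord = (fun a : ℝ => ⌈a⌉₊ - 1))
    {α C : ℝ} (hα : 0 < α) (hC : 0 < C) :
    ∃ E : ℕ, 4 ≤ E ∧ ∃ h : ℝ → ℝ → ℝ, ∀ s : ℝ, 0 ≤ s → s ≤ 1 / E →
      h s ∈ HolderClass (ord α) α C ∩ HolderClass (ord 1) 1 1 ∧ Continuous (h s) ∧
        ∀ t ∈ Set.Icc (0 : ℝ) 1, h s t = 1 / 2 - s * t := by
  obtain ⟨ψ, hψ, hc, hψt⟩ := exists_smooth_ramp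
  obtain ⟨a0, a1⟩ := sub_ord_mem_Icc hord hα
  obtain ⟨b0, b1⟩ := sub_ord_mem_Icc hord one_pos
  obtain ⟨s₁, hs₁, h₁⟩ := exists_holderClass_of_smooth hψ hc hC a0 a1 (1 / 2)
  obtain ⟨s₂, hs₂, h₂⟩ := exists_holderClass_of_smooth hψ hc one_pos b0 b1 (1 / 2)
  obtain ⟨N, hN⟩ := exists_nat_gt (1 / min s₁ s₂)
  have hmin : 0 < min s₁ s₂ := lt_min hs₁ hs₂
  refine ⟨max N 4, le_max_right _ _, fun s t => 1 / 2 - s * ψ t, fun s hs0 hs => ?_⟩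
  have hle : s ≤ min s₁ s₂ := by
    refine hs.trans ?_
    have h4 : (0 : ℝ) < (max N 4 : ℕ) := by
      exact_mod_cast lt_of_lt_of_le (by norm_num) (le_max_right N 4)
    rw [one_div_le h4 hmin]
    exact hN.le.trans (by exact_mod_cast le_max_left N 4)
  refine ⟨⟨h₁ s hs0 (hle.trans (min_le_left _ _)), h₂ s hs0 (hle.trans (min_le_right _ _))⟩,
    continuous_const.sub (continuous_const.mul hψ.continuous), fun t ht => ?_⟩
  simp [hψt t ht]

/-! ### The lower bound -/

theorem half_le_norm_sq_add (z : ℂ) : 1 / 2 ≤ ‖1 - z‖ ^ 2 + ‖z‖ ^ 2 := by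
  have h : (1 : ℝ) ≤ ‖1 - z‖ + ‖z‖ := by
    have := norm_add_le (1 - z) z
    simpa using this
  nlinarith [sq_nonneg (‖1 - z‖ - ‖z‖), norm_nonneg (1 - z), norm_nonneg z]

/-- Sum the frequency bound over all slopes. Each frequency of the block is strongly excited by at
least one slope, whereas its noise term is paid once for every slope. By pigeonhole some slope has
at least the average risk. -/
theorem exists_slope_risk_ge {g : ℤ → ℤ → ℝ} (hg : Summable fun p : ℤ × ℤ => g p.1 p.2)
    (σ : ℝ) {n : ℕ} [NeZero n] {E M : ℕ} (hE : 4 ≤ E) (hM : 0 < M) (hn : 96 * (E * M) ≤ n)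
    (h : ℕ → ℝ → ℝ) (hh : ∀ r ≤ 16 * M, ∀ t ∈ Set.Icc (0 : ℝ) 1,
      h r t = 1 / 2 - r / (16 * (E * M)) * t) :
    ∃ r ≤ 16 * M, (E * M : ℝ) / 34 *
        min (1 / (8 * Real.pi * (E * M)) ^ 2) (16 * M * (σ ^ 2 / (n : ℝ) ^ 2)) ≤
      1 / (n : ℝ) ^ 2 * ∑ i : ZMod n, ∑ j : ZMod n,
          bias g (fun i j : ZMod n => cellAverage (h r) n i.val j.val) i j ^ 2 +
        σ ^ 2 * ∑ c, periodize g n c ^ 2 := by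
  set K : ℕ := E * M with hK
  have hK0 : 0 < K := Nat.mul_pos (by omega) hM
  have hMK : 4 * M ≤ K := Nat.mul_le_mul_right M hE
  have hKr : (0 : ℝ) < K := by exact_mod_cast hK0
  have hMr : (0 : ℝ) < M := by exact_mod_cast hM
  have hn0 : (0 : ℝ) < n := by exact_mod_cast Nat.pos_of_neZero n
  have hKc : (E * M : ℝ) = K := by rw [hK]; push_cast; rfl
  simp only [hKc] at hh ⊢
  set G := torusDFT (periodize g n)
  set x : ℕ → ZMod n → ZMod n → ℝ := fun r i j => cellAverage (h r) n i.val j.val with hx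
  -- Here `k₁ / k₂ ≤ M / K = 1 / E`, so the directions in the block match admissible slopes.
  set Q : Finset (ℕ × ℕ) := Finset.Icc 1 M ×ˢ Finset.Ico K (2 * K) with hQ
  set cast : ℕ × ℕ → ZMod n × ZMod n := fun q => ((q.1 : ZMod n), (q.2 : ZMod n)) with hcast
  have hQlt : ∀ q ∈ Q, q.1 < n ∧ q.2 < n := by
    intro q hq
    simp only [hQ, Finset.mem_product, Finset.mem_Icc, Finset.mem_Ico] at hq
    omega
  have hinj : Set.InjOn cast Q := by
    intro q hq q' hq' he
    have h1 := congrArg ZMod.val (congrArg Prod.fst he)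
    have h2 := congrArg ZMod.val (congrArg Prod.snd he)
    simp only [hcast, ZMod.val_cast_of_lt (hQlt q hq).1, ZMod.val_cast_of_lt (hQlt q hq).2,
      ZMod.val_cast_of_lt (hQlt q' hq').1, ZMod.val_cast_of_lt (hQlt q' hq').2] at h1 h2
    exact Prod.ext h1 h2
  set τ : ℝ := 1 / (8 * Real.pi * K) ^ 2 with hτ
  have hhit : ∀ q ∈ Q, ∃ r ∈ Finset.range (16 * M + 1),
      τ ≤ ‖torusDFT (fun a => x r a.1 a.2) (cast q)‖ ^ 2 / (n : ℝ) ^ 4 := by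
    rintro ⟨k₁, k₂⟩ hq
    have hlt := hQlt _ hq
    simp only [hQ, Finset.mem_product, Finset.mem_Icc, Finset.mem_Ico] at hq hlt
    obtain ⟨⟨hk1, hk1M⟩, hk2, hk2K⟩ := hq
    have hk20 : (0 : ℝ) < k₂ := by exact_mod_cast hK0.trans_le hk2
    have hk2r : (K : ℝ) ≤ k₂ := by exact_mod_cast hk2
    have hk2K' : (k₂ : ℝ) ≤ 2 * K := by exact_mod_cast hk2K.le
    have hk1M' : (k₁ : ℝ) ≤ M := by exact_mod_cast hk1M
    -- Rounding `k₁ / k₂` down to the grid of step `1 / (16 K)` costs at most `k₂ / (16 K) ≤ 1 / 8`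
    -- in `k₁ - s k₂`.
    set r : ℕ := ⌊16 * K * k₁ / (k₂ : ℝ)⌋₊ with hr
    have hr1 : (r : ℝ) ≤ 16 * K * k₁ / k₂ := Nat.floor_le (by positivity)
    have hr2 : 16 * K * k₁ / (k₂ : ℝ) < r + 1 := Nat.lt_floor_add_one _
    rw [le_div_iff₀ hk20] at hr1
    rw [div_lt_iff₀ hk20] at hr2
    have hr16 : (r : ℝ) ≤ 16 * M := by
      have h1 : (r : ℝ) * K ≤ 16 * K * k₁ := by nlinarith [(Nat.cast_nonneg r : (0 : ℝ) ≤ r)]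
      have h2 : (r : ℝ) * K ≤ (16 * M) * K := by nlinarith
      exact le_of_mul_le_mul_right h2 hKr
    have hr16' : r ≤ 16 * M := by exact_mod_cast hr16
    refine ⟨r, Finset.mem_range.2 (by omega), ?_⟩
    have hslope : (r : ℝ) / (16 * K) ≤ 1 / 4 := by
      rw [div_le_iff₀ (by positivity)]
      have : (4 * M : ℝ) ≤ K := by exact_mod_cast hMK
      linarith
    have hdist : |(k₁ : ℝ) - r / (16 * K) * k₂| ≤ 1 / 8 := by
      rw [div_mul_eq_mul_div, abs_le]
      constructor
      · have : (r : ℝ) * k₂ / (16 * K) ≤ k₁ := by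
          rw [div_le_iff₀ (by positivity)]; linarith
        linarith
      · have : (k₁ : ℝ) - 1 / 8 ≤ r * k₂ / (16 * K) := by
          rw [le_div_iff₀ (by positivity)]; nlinarith
        linarith
    have hbig := norm_torusDFT_edge_ge (h := h r) (n := n) (by positivity) hslope (hh r hr16') hk1
      hlt.1 (hK0.trans_le hk2) (by omega) hdist
    set T := ‖torusDFT (fun a => x r a.1 a.2) (cast (k₁, k₂))‖ with hT
    have hT' : (n : ℝ) ^ 2 ≤ 8 * Real.pi * K * T := by
      refine hbig.trans ?_
      have h0 : 0 ≤ T := norm_nonneg _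
      calc 4 * Real.pi * k₂ * T ≤ 4 * Real.pi * (2 * K) * T := by gcongr
        _ = 8 * Real.pi * K * T := by ring
    rw [hτ, le_div_iff₀ (by positivity), one_div, inv_mul_le_iff₀ (by positivity), ← mul_pow]
    calc (n : ℝ) ^ 4 = ((n : ℝ) ^ 2) ^ 2 := by ring
      _ ≤ _ := by gcongr
  set ρ : ℕ → ℝ := fun r => 1 / (n : ℝ) ^ 2 * ∑ i : ZMod n, ∑ j : ZMod n, bias g (x r) i j ^ 2 +
        σ ^ 2 * ∑ c, periodize g n c ^ 2 with hρ
  set m := min τ (16 * M * (σ ^ 2 / (n : ℝ) ^ 2)) with hm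
  have hm0 : 0 ≤ m := le_min (by positivity) (by positivity)
  have hρr : ∀ r, ∑ q ∈ Q, (‖1 - G (cast q)‖ ^ 2 *
      (‖torusDFT (fun a => x r a.1 a.2) (cast q)‖ ^ 2 / (n : ℝ) ^ 4) +
        σ ^ 2 / (n : ℝ) ^ 2 * ‖G (cast q)‖ ^ 2) ≤ ρ r := by
    intro r
    have h1 := sum_freq_le_bias_add_variance hg σ (x r) (Q.image cast)
    rwa [Finset.sum_image hinj] at h1
  have hsum : ∑ q ∈ Q, m / 2 ≤ ∑ r ∈ Finset.range (16 * M + 1), ρ r := by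
    refine le_trans ?_ (Finset.sum_le_sum fun r _ => hρr r)
    rw [Finset.sum_comm]
    refine Finset.sum_le_sum fun q hq => ?_
    obtain ⟨r₀, hr₀, hbig⟩ := hhit q hq
    rw [Finset.sum_add_distrib, ← Finset.mul_sum, Finset.sum_const, Finset.card_range,
      nsmul_eq_mul]
    have h1 : m ≤ ∑ r ∈ Finset.range (16 * M + 1),
        ‖torusDFT (fun a => x r a.1 a.2) (cast q)‖ ^ 2 / (n : ℝ) ^ 4 :=
      ((min_le_left _ _).trans hbig).trans (Finset.single_le_sum
        (f := fun r => ‖torusDFT (fun a => x r a.1 a.2) (cast q)‖ ^ 2 / (n : ℝ) ^ 4)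
        (fun r _ => by positivity) hr₀)
    have h2 : m ≤ ((16 * M + 1 : ℕ) : ℝ) * (σ ^ 2 / (n : ℝ) ^ 2) := by
      refine (min_le_right _ _).trans (mul_le_mul_of_nonneg_right ?_ (by positivity))
      push_cast; linarith
    calc m / 2 ≤ (‖1 - G (cast q)‖ ^ 2 + ‖G (cast q)‖ ^ 2) * m := by
          nlinarith [half_le_norm_sq_add (G (cast q))]
      _ = ‖1 - G (cast q)‖ ^ 2 * m + m * ‖G (cast q)‖ ^ 2 := by ring
      _ ≤ _ := by
          rw [← mul_assoc]
          gcongr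
  have hcard : (Q.card : ℝ) = M * K := by
    rw [hQ, Finset.card_product, Nat.card_Icc, Nat.card_Ico]
    have : 2 * K - K = K := by omega
    rw [this]; push_cast; simp
  rw [Finset.sum_const, nsmul_eq_mul, hcard] at hsum
  -- There are `16 M + 1 ≤ 17 M` slopes, and the block total is `M K m / 2`, whence `34`.
  have hconst : ∑ r ∈ Finset.range (16 * M + 1), (K : ℝ) / 34 * m ≤
      ∑ r ∈ Finset.range (16 * M + 1), ρ r := by
    refine le_trans ?_ hsum
    rw [Finset.sum_const, Finset.card_range, nsmul_eq_mul]
    have hM1 : (1 : ℝ) ≤ M := by exact_mod_cast hM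
    have : ((16 * M + 1 : ℕ) : ℝ) ≤ 17 * M := by push_cast; linarith
    calc ((16 * M + 1 : ℕ) : ℝ) * ((K : ℝ) / 34 * m) ≤ 17 * M * ((K : ℝ) / 34 * m) := by gcongr
      _ = M * K * (m / 2) := by ring
  obtain ⟨r, hr, hle⟩ := Finset.exists_le_of_sum_le ⟨0, by simp⟩ hconst
  exact ⟨r, by simpa [Nat.lt_succ_iff] using hr, hle⟩

theorem exists_minimaxRisk_ge {ord : ℝ → ℕ}
    (hord : ord = (fun a : ℝ => ⌊a⌋₊) ∨ ord = (fun a : ℝ => ⌈a⌉₊ - 1))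
    {α C : ℝ} (hα : 0 < α) (hC : 0 < C) {σ : ℝ≥0} (hσ : 0 < σ) :
    ∃ c : ℝ, 0 < c ∧ ∃ n₀ : ℕ, ∀ (n : ℕ) [NeZero n], n₀ < n →
      ENNReal.ofReal (c * (n : ℝ) ^ (-(2 / 3) : ℝ)) ≤ minimaxRisk ord α C σ n := by
  obtain ⟨E, hE, h, hh⟩ := exists_straight_contours hord hα hC
  have hE0 : (0 : ℝ) < E := by exact_mod_cast (by omega : 0 < E)
  have hσ' : (0 : ℝ) < σ := by exact_mod_cast hσ
  -- `2176 = 34 * 8 ^ 2`, and `2 / 17` is `16 / 34` times the `1 / 4` lost in `M ≥ n^(2/3) / 2`. The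
  -- threshold `(96 E)³` ensures `96 E M ≤ n`.
  refine ⟨min (1 / (2176 * Real.pi ^ 2 * E)) (2 / 17 * E * σ ^ 2), by positivity,
    (96 * E) ^ 3, fun n _ hn => ?_⟩
  have hn1 : (1 : ℝ) ≤ n := by exact_mod_cast Nat.pos_of_neZero n
  have hn0 : (0 : ℝ) < n := by linarith
  set y : ℝ := (n : ℝ) ^ (1 / 3 : ℝ) with hy
  have hy0 : 0 < y := by positivity
  have hy3 : y ^ 3 = n := by
    rw [hy, ← Real.rpow_natCast, ← Real.rpow_mul hn0.le]; norm_num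
  have hyE : 96 * (E : ℝ) ≤ y := by
    have h1 : (96 * (E : ℝ)) ^ 3 ≤ y ^ 3 := by rw [hy3]; exact_mod_cast hn.le
    exact le_of_pow_le_pow_left₀ (by norm_num) hy0.le h1
  have hyn : (n : ℝ) ^ (-(2 / 3) : ℝ) = 1 / y ^ 2 := by
    rw [hy, ← Real.rpow_natCast, ← Real.rpow_mul hn0.le, one_div, ← Real.rpow_neg hn0.le]; norm_num
  have hE4 : (4 : ℝ) ≤ E := by exact_mod_cast hE
  have hy1 : 1 ≤ y ^ 2 := by nlinarith
  set M : ℕ := ⌊y ^ 2⌋₊ with hM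
  have hM0 : 0 < M := Nat.floor_pos.2 hy1
  have hM1 : (1 : ℝ) ≤ M := by exact_mod_cast hM0
  have hMle : (M : ℝ) ≤ y ^ 2 := Nat.floor_le (by positivity)
  have hMge : y ^ 2 / 2 ≤ M := by
    have := Nat.lt_floor_add_one (y ^ 2)
    linarith
  have hKn : 96 * (E * M) ≤ n := by
    have : (96 * (E * M) : ℝ) ≤ n := by
      rw [← hy3]
      calc (96 * (E * M) : ℝ) = 96 * E * M := by ring
        _ ≤ y * y ^ 2 := by gcongr
        _ = y ^ 3 := by ring
    exact_mod_cast this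
  refine le_iInf₂ fun g hg => ?_
  have hgs : Summable fun p : ℤ × ℤ => g p.1 p.2 := hg.hasSum_one.summable
  have hslope : ∀ r ≤ 16 * M, (r : ℝ) / (16 * (E * M)) ≤ 1 / E := by
    intro r hr
    have : (r : ℝ) ≤ 16 * M := by exact_mod_cast hr
    rw [div_le_div_iff₀ (by positivity) hE0]
    nlinarith
  obtain ⟨r, hr, hle⟩ := exists_slope_risk_ge hgs σ hE hM0 hKn
    (fun r => h (r / (16 * (E * M)))) fun r hr => (hh _ (by positivity) (hslope r hr)).2.2
  obtain ⟨hmem, hcont, -⟩ := hh ((r : ℝ) / (16 * (E * M))) (by positivity) (hslope r hr)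
  refine le_trans ?_ (le_iSup₂_of_le (horizonImage (h (r / (16 * (E * M))))) ⟨_, hmem, rfl⟩ le_rfl)
  rw [risk_eq hgs]
  refine ENNReal.ofReal_le_ofReal ?_
  have hpix : pixelAverage n (horizonImage (h (r / (16 * (E * M))))) =
      fun i j => cellAverage (h (r / (16 * (E * M)))) n i.val j.val := by
    ext i j; exact pixelAverage_horizonImage hcont i j
  rw [hpix]
  refine le_trans ?_ hle
  rw [mul_min_of_nonneg _ _ (by positivity), hyn, min_mul_of_nonneg _ _ (by positivity)]
  refine min_le_min ?_ ?_
  · calc 1 / (2176 * Real.pi ^ 2 * E) * (1 / y ^ 2) = 1 / (2176 * Real.pi ^ 2 * E * y ^ 2) := by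
          field_simp
      _ ≤ 1 / (2176 * Real.pi ^ 2 * E * M) := by gcongr
      _ = _ := by field_simp; ring
  · rw [← hy3]
    calc 2 / 17 * E * (σ : ℝ) ^ 2 * (1 / y ^ 2) =
          8 / 17 * E * (σ : ℝ) ^ 2 * ((y ^ 2 / 2) ^ 2 / (y ^ 3) ^ 2) := by field_simp; ring
      _ ≤ 8 / 17 * E * (σ : ℝ) ^ 2 * ((M : ℝ) ^ 2 / (y ^ 3) ^ 2) := by gcongr
      _ = _ := by ring

/-! ### Variation of an image along shifts of the torus -/

section ShiftVariation

variable {A : Type*} [AddCommGroup A] [Fintype A]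

/-- The `ℓ¹` distance between a function on a finite group and its translate by `c`. -/
def shiftVariation (x : A → ℝ) (c : A) : ℝ := ∑ a, |x a - x (a - c)|

theorem shiftVariation_nonneg (x : A → ℝ) (c : A) : 0 ≤ shiftVariation x c :=
  Finset.sum_nonneg fun _ _ => abs_nonneg _

theorem shiftVariation_add_le (x : A → ℝ) (c d : A) :
    shiftVariation x (c + d) ≤ shiftVariation x c + shiftVariation x d := by
  have h : shiftVariation x d = ∑ a, |x (a - c) - x (a - c - d)| :=
    (Equiv.sum_comp (Equiv.subRight c) fun a => |x a - x (a - d)|).symm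
  rw [h, shiftVariation, shiftVariation, ← Finset.sum_add_distrib]
  refine Finset.sum_le_sum fun a _ => ?_
  rw [← sub_sub]
  exact abs_sub_le _ _ _

theorem shiftVariation_neg (x : A → ℝ) (c : A) :
    shiftVariation x (-c) = shiftVariation x c := by
  rw [shiftVariation, shiftVariation, ← Equiv.sum_comp (Equiv.subRight c)]
  refine Finset.sum_congr rfl fun a _ => ?_
  simp [abs_sub_comm]

theorem shiftVariation_nsmul_le (x : A → ℝ) (c : A) (m : ℕ) :
    shiftVariation x (m • c) ≤ m * shiftVariation x c := by
  induction m with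
  | zero => simp [shiftVariation]
  | succ m ih =>
    rw [succ_nsmul]
    refine (shiftVariation_add_le x _ _).trans ?_
    push_cast
    linarith

theorem shiftVariation_zsmul_le (x : A → ℝ) (c : A) (m : ℤ) :
    shiftVariation x (m • c) ≤ |(m : ℝ)| * shiftVariation x c := by
  rcases Int.eq_nat_or_neg m with ⟨k, rfl | rfl⟩
  · simpa using shiftVariation_nsmul_le x c k
  · simpa [shiftVariation_neg] using shiftVariation_nsmul_le x c k

end ShiftVariation

/-- Reach `p` by unit steps; by translation invariance each step costs at most `W`. -/
theorem shiftVariation_reduce_le {n : ℕ} [NeZero n] {x : ZMod n × ZMod n → ℝ} {W : ℝ}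
    (h₁ : shiftVariation x (1, 0) ≤ W) (h₂ : shiftVariation x (0, 1) ≤ W) (p : ℤ × ℤ) :
    shiftVariation x (reduce n p) ≤ W * (|(p.1 : ℝ)| + |(p.2 : ℝ)|) := by
  have h : reduce n p = p.1 • ((1, 0) : ZMod n × ZMod n) + p.2 • ((0, 1) : ZMod n × ZMod n) := by
    simp [reduce]
  rw [h]
  refine (shiftVariation_add_le x _ _).trans ?_
  have e₁ := (shiftVariation_zsmul_le x (1, 0) p.1).trans
    (mul_le_mul_of_nonneg_left h₁ (abs_nonneg _))
  have e₂ := (shiftVariation_zsmul_le x (0, 1) p.2).trans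
    (mul_le_mul_of_nonneg_left h₂ (abs_nonneg _))
  linarith

/-! ### Variation of horizon images -/

theorem intCast_val_sub_one {n : ℕ} [NeZero n] {b : ZMod n} (hb : b ≠ 0) :
    ((b - 1).val : ℤ) = b.val - 1 := by
  have hbv : 1 ≤ b.val := Nat.one_le_iff_ne_zero.2 ((ZMod.val_ne_zero b).2 hb)
  have := ZMod.val_lt b
  rw [val_sub_one_of_ne_zero (by omega) hb]
  push_cast [hbv]
  ring

/-- The signed differences around the cycle sum to zero, and only the wrap-around one can be
positive. It is at most 1. -/
theorem sum_abs_cyclic_diff_le_of_antitone {n : ℕ} [NeZero n] {v : ℤ → ℝ} (hv : Antitone v)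
    (h0 : ∀ j, 0 ≤ v j) (h1 : ∀ j, v j ≤ 1) :
    ∑ b : ZMod n, |v b.val - v (b - 1).val| ≤ 2 := by
  have hzero : ∑ b : ZMod n, (v b.val - v (b - 1).val) = 0 := by
    rw [Finset.sum_sub_distrib, sub_eq_zero]
    exact (Equiv.sum_comp (Equiv.subRight (1 : ZMod n)) fun b => v b.val).symm
  have hle : ∀ b : ZMod n, |v b.val - v (b - 1).val| ≤
      -(v b.val - v (b - 1).val) + if b = 0 then 2 else 0 := by
    intro b
    by_cases hb : b = 0
    · have := h0 b.val
      have := h1 b.val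
      have := h0 (b - 1).val
      have := h1 (b - 1).val
      rw [if_pos hb, abs_le]
      constructor <;> linarith
    · rw [if_neg hb, add_zero, abs_of_nonpos]
      rw [sub_nonpos]
      exact hv (by rw [intCast_val_sub_one hb]; omega)
  refine (Finset.sum_le_sum fun b _ => hle b).trans ?_
  rw [Finset.sum_add_distrib, Finset.sum_neg_distrib, hzero]
  simp

theorem sum_abs_cyclic_diff_le_of_monotone {n : ℕ} [NeZero n] {v : ℤ → ℝ} (hv : Monotone v)
    (h0 : ∀ j, 0 ≤ v j) (h1 : ∀ j, v j ≤ 1) :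
    ∑ b : ZMod n, |v b.val - v (b - 1).val| ≤ 2 := by
  have h := sum_abs_cyclic_diff_le_of_antitone (n := n) (v := fun j => 1 - v j)
    (fun i j hij => sub_le_sub_left (hv hij) 1) (fun j => by linarith [h1 j])
    (fun j => by linarith [h0 j])
  refine le_of_eq_of_le (Finset.sum_congr rfl fun b _ => ?_) h
  rw [sub_sub_sub_cancel_left, abs_sub_comm]

theorem sum_zmod_val {n : ℕ} [NeZero n] (f : ℕ → ℝ) :
    ∑ b : ZMod n, f b.val = ∑ j ∈ Finset.range n, f j := by
  obtain ⟨m, rfl⟩ : ∃ m, n = m + 1 := ⟨n - 1, (Nat.succ_pred (NeZero.ne n)).symm⟩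
  exact Fin.sum_univ_eq_sum_range f (m + 1)

theorem sum_shift_diff_le {n : ℕ} [NeZero n] {w : ℤ → ℝ} (h0 : ∀ j, 0 ≤ w j)
    (h1 : ∀ j, w j ≤ 1) : ∑ b : ZMod n, (w (b.val - 2) - w (b.val + 2)) ≤ 4 := by
  rw [sum_zmod_val fun j => w ((j : ℤ) - 2) - w ((j : ℤ) + 2)]
  have htel : ∀ c : ℤ, ∑ j ∈ Finset.range n, (w (j + c) - w (j + (c + 1))) ≤ 1 := by
    intro c
    have h := Finset.sum_range_sub' (fun j : ℕ => w (j + c)) n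
    have e : ∀ j : ℕ, w (((j + 1 : ℕ) : ℤ) + c) = w (j + (c + 1)) := fun j => by
      congr 1; push_cast; ring
    simp only [e] at h
    rw [h]
    linarith [h1 (((0 : ℕ) : ℤ) + c), h0 ((n : ℤ) + c)]
  have h := add_le_add (add_le_add (htel (-2)) (htel (-1))) (add_le_add (htel 0) (htel 1))
  simp only [← Finset.sum_add_distrib] at h
  refine le_trans (le_of_eq (Finset.sum_congr rfl fun j _ => ?_)) (h.trans (by norm_num))
  norm_num
  ring_nf

/-- Moving one column moves the edge by at most two cells, so both averages lie between those of one
column shifted by two cells down and up. The resulting bound telescopes over a column. -/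
theorem abs_cellAverage_sub_le_of_lipschitz {h : ℝ → ℝ} (hL : ∀ t t', |h t - h t'| ≤ 2 * |t - t'|)
    {n : ℕ} [NeZero n] (i j : ℤ) :
    |cellAverage h n i j - cellAverage h n (i - 1) j| ≤
      cellAverage h n (i - 1) (j - 2) - cellAverage h n (i - 1) (j + 2) := by
  have hn : (0 : ℝ) < n := by exact_mod_cast Nat.pos_of_neZero n
  have hstep : ∀ u : ℝ × ℝ, |h ((i + u.1) / n) - h (((i - 1 : ℤ) + u.1) / n)| ≤ 2 / n := by
    intro u
    refine (hL _ _).trans (le_of_eq ?_)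
    have : ((i : ℝ) + u.1) / n - ((i - 1 : ℤ) + u.1) / n = 1 / n := by push_cast; field_simp; ring
    rw [this, abs_of_pos (by positivity)]
    ring
  have hA : cellAverage h n i j ≤ cellAverage h n (i - 1) (j - 2) := by
    refine cellAverage_mono fun u _ hu => ?_
    have h1 := (abs_le.1 (hstep u)).2
    have h2 : (((j - 2 : ℤ) : ℝ) + u.2) / n = (j + u.2) / n - 2 / n := by
      push_cast; field_simp; ring
    rw [h2]; linarith
  have hB : cellAverage h n (i - 1) (j + 2) ≤ cellAverage h n i j := by
    refine cellAverage_mono fun u _ hu => ?_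
    have h1 := (abs_le.1 (hstep u)).1
    have h2 : (((j + 2 : ℤ) : ℝ) + u.2) / n = (j + u.2) / n + 2 / n := by
      push_cast; field_simp; ring
    rw [h2] at hu; linarith
  have hC : cellAverage h n (i - 1) j ≤ cellAverage h n (i - 1) (j - 2) :=
    cellAverage_antitone_snd h n (i - 1) (by omega)
  have hD : cellAverage h n (i - 1) (j + 2) ≤ cellAverage h n (i - 1) j :=
    cellAverage_antitone_snd h n (i - 1) (by omega)
  rw [abs_le]
  constructor <;> linarith

theorem abs_cellAverage_sub_le_one (h : ℝ → ℝ) (n : ℕ) (i j i' j' : ℤ) :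
    |cellAverage h n i j - cellAverage h n i' j'| ≤ 1 := by
  have := cellAverage_nonneg h n i j
  have := cellAverage_nonneg h n i' j'
  have := cellAverage_le_one h n i j
  have := cellAverage_le_one h n i' j'
  rw [abs_le]
  constructor <;> linarith

/-- The image of the cell averages of the subgraph of `h` on the discrete torus. -/
def cellImage (h : ℝ → ℝ) (n : ℕ) (a : ZMod n × ZMod n) : ℝ := cellAverage h n a.1.val a.2.val

theorem shiftVariation_cellImage_snd_le (h : ℝ → ℝ) (n : ℕ) [NeZero n] :
    shiftVariation (cellImage h n) (0, 1) ≤ 5 * n := by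
  rw [shiftVariation, Fintype.sum_prod_type]
  have : ∀ a : ZMod n, ∑ b : ZMod n,
      |cellImage h n (a, b) - cellImage h n ((a, b) - (0, 1))| ≤ 2 := by
    intro a
    have := sum_abs_cyclic_diff_le_of_antitone (n := n) (cellAverage_antitone_snd h n a.val)
      (cellAverage_nonneg h n _) (cellAverage_le_one h n _)
    simpa [cellImage] using this
  refine (Finset.sum_le_sum fun a _ => this a).trans ?_
  have hn : (0 : ℝ) ≤ n := Nat.cast_nonneg n
  simp [ZMod.card]
  linarith

/-- For monotone `h` each row has cyclic variation at most 2. In the Lipschitz case each column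
differs from its predecessor by at most 4 in `ℓ¹`, except the wrap-around column, which may differ
by `n`. -/
theorem shiftVariation_cellImage_fst_le {h : ℝ → ℝ}
    (hh : Monotone h ∨ Antitone h ∨ ∀ t t', |h t - h t'| ≤ 2 * |t - t'|) (n : ℕ) [NeZero n] :
    shiftVariation (cellImage h n) (1, 0) ≤ 5 * n := by
  have hn : (0 : ℝ) ≤ n := Nat.cast_nonneg n
  have hmono : (∀ b : ZMod n, ∑ a : ZMod n,
      |cellImage h n (a, b) - cellImage h n ((a, b) - (1, 0))| ≤ 2) →
      shiftVariation (cellImage h n) (1, 0) ≤ 5 * n := by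
    intro H
    rw [shiftVariation, Fintype.sum_prod_type_right]
    refine (Finset.sum_le_sum fun a _ => H a).trans ?_
    simp [ZMod.card]
    linarith
  rcases hh with hh | hh | hh
  · refine hmono fun b => ?_
    have := sum_abs_cyclic_diff_le_of_monotone (n := n) (cellAverage_monotone_fst hh n b.val)
      (fun i => cellAverage_nonneg h n i _) (fun i => cellAverage_le_one h n i _)
    simpa [cellImage] using this
  · refine hmono fun b => ?_
    have := sum_abs_cyclic_diff_le_of_antitone (n := n) (cellAverage_antitone_fst hh n b.val)
      (fun i => cellAverage_nonneg h n i _) (fun i => cellAverage_le_one h n i _)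
    simpa [cellImage] using this
  · rw [shiftVariation, Fintype.sum_prod_type]
    have : ∀ a : ZMod n, ∑ b : ZMod n,
        |cellImage h n (a, b) - cellImage h n ((a, b) - (1, 0))| ≤
        4 + if a = 0 then (n : ℝ) else 0 := by
      intro a
      by_cases ha : a = 0
      · rw [if_pos ha]
        refine (Finset.sum_le_sum fun b _ => abs_cellAverage_sub_le_one h n _ _ _ _).trans ?_
        simp [ZMod.card]
      · rw [if_neg ha, add_zero]
        refine le_trans (Finset.sum_le_sum fun b _ => ?_)
          (sum_shift_diff_le (n := n) (w := fun j => cellAverage h n ((a.val : ℤ) - 1) j)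
            (cellAverage_nonneg h n _) (cellAverage_le_one h n _))
        have h1 := abs_cellAverage_sub_le_of_lipschitz hh (n := n) a.val b.val
        simpa [cellImage, intCast_val_sub_one ha] using h1
    refine (Finset.sum_le_sum fun a _ => this a).trans ?_
    rw [Finset.sum_add_distrib]
    simp [ZMod.card]
    linarith

/-- With the floor convention, `Hölder^1(1)` only says that `h'` oscillates by at most 1, so `h` may
be arbitrarily steep. But then `h'` has constant sign; otherwise `|h'| ≤ 2`. -/
theorem contour_regularity {ord : ℝ → ℕ}
    (hord : ord = (fun a : ℝ => ⌊a⌋₊) ∨ ord = (fun a : ℝ => ⌈a⌉₊ - 1)) {h : ℝ → ℝ}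
    (hh : h ∈ HolderClass (ord 1) 1 1) :
    Continuous h ∧ (Monotone h ∨ Antitone h ∨ ∀ t t', |h t - h t'| ≤ 2 * |t - t'|) := by
  have hk : ord 1 = 1 ∨ ord 1 = 0 := by rcases hord with rfl | rfl <;> simp
  obtain ⟨hd, hb⟩ := hh
  rcases hk with hk | hk
  · rw [hk] at hd hb
    have hdiff : Differentiable ℝ h := by simpa using hd 0 one_pos
    simp only [iteratedDeriv_one, Nat.cast_one, sub_self, Real.rpow_zero, mul_one] at hb
    refine ⟨hdiff.continuous, ?_⟩
    rcases le_total 1 (deriv h 0) with h1 | h1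
    · exact Or.inl (monotone_of_deriv_nonneg hdiff fun t => by linarith [(abs_le.1 (hb t 0)).1])
    rcases le_total (deriv h 0) (-1) with h2 | h2
    · exact Or.inr (Or.inl (antitone_of_deriv_nonpos hdiff fun t => by
        linarith [(abs_le.1 (hb t 0)).2]))
    refine Or.inr (Or.inr fun t t' => ?_)
    have := Convex.norm_image_sub_le_of_norm_deriv_le (f := h) (s := Set.univ)
      (C := 2) (fun x _ => hdiff x) (fun x _ => by
        rw [Real.norm_eq_abs, abs_le]
        obtain ⟨e1, e2⟩ := abs_le.1 (hb x 0)
        constructor <;> linarith) convex_univ (Set.mem_univ t') (Set.mem_univ t)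
    simpa [Real.norm_eq_abs] using this
  · rw [hk] at hb
    simp only [iteratedDeriv_zero, Nat.cast_zero, sub_zero, Real.rpow_one, one_mul] at hb
    refine ⟨?_, Or.inr (Or.inr fun t t' => (hb t t').trans ?_)⟩
    · exact (LipschitzWith.of_dist_le_mul (K := 1) fun t t' => by
        simpa [Real.dist_eq] using hb t t').continuous
    · linarith [abs_nonneg (t - t')]

/-! ### Risk of a localized filter -/

/-- Since `g` has mass 1, the bias is an average of the differences `x a - x (a - p)` with weights
`g p`. Its squared `ℓ²` norm is at most its sup norm times its `ℓ¹` norm. The former is bounded by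
`∑ |g|` and the latter by the shift variations. -/
theorem sum_sq_bias_le {g : ℤ → ℤ → ℝ} (hg : HasSum (fun p : ℤ × ℤ => g p.1 p.2) 1)
    (hmom : Summable fun p : ℤ × ℤ => |g p.1 p.2| * (|(p.1 : ℝ)| + |(p.2 : ℝ)|))
    {n : ℕ} [NeZero n] {x : ZMod n × ZMod n → ℝ} (hx : ∀ a b, |x a - x b| ≤ 1) {W : ℝ}
    (h₁ : shiftVariation x (1, 0) ≤ W) (h₂ : shiftVariation x (0, 1) ≤ W) :
    ∑ i : ZMod n, ∑ j : ZMod n, bias g (fun i j => x (i, j)) i j ^ 2 ≤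
      (∑' p : ℤ × ℤ, |g p.1 p.2|) *
        (W * ∑' p : ℤ × ℤ, |g p.1 p.2| * (|(p.1 : ℝ)| + |(p.2 : ℝ)|)) := by
  have hsa : Summable fun p : ℤ × ℤ => |g p.1 p.2| := hg.summable.abs
  set B := ∑' p : ℤ × ℤ, |g p.1 p.2| with hB
  have hbias : ∀ a : ZMod n × ZMod n, bias g (fun i j => x (i, j)) a.1 a.2 =
      ∑' p : ℤ × ℤ, g p.1 p.2 * (x a - x (a - reduce n p)) := by
    intro a
    have hs : Summable fun p : ℤ × ℤ => g p.1 p.2 * x (a - reduce n p) := by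
      obtain ⟨A, hA⟩ : ∃ A, ∀ b, |x b| ≤ A := by
        refine ⟨∑ b, |x b|, fun b => ?_⟩
        exact Finset.single_le_sum (f := fun b => |x b|) (fun _ _ => abs_nonneg _)
          (Finset.mem_univ b)
      refine Summable.of_norm_bounded (hsa.mul_right A) fun p => ?_
      rw [norm_mul, Real.norm_eq_abs, Real.norm_eq_abs]
      exact mul_le_mul_of_nonneg_left (hA _) (abs_nonneg _)
    simp_rw [mul_sub]
    rw [Summable.tsum_sub (hg.summable.mul_right _) hs, tsum_mul_right, hg.tsum_eq, one_mul]
    rfl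
  have hterm : ∀ a : ZMod n × ZMod n,
      Summable fun p : ℤ × ℤ => |g p.1 p.2| * |x a - x (a - reduce n p)| := fun a =>
    Summable.of_nonneg_of_le (fun p => by positivity)
      (fun p => mul_le_of_le_one_right (abs_nonneg _) (hx _ _)) hsa
  have habs : ∀ a : ZMod n × ZMod n, |bias g (fun i j => x (i, j)) a.1 a.2| ≤
      ∑' p : ℤ × ℤ, |g p.1 p.2| * |x a - x (a - reduce n p)| := by
    intro a
    rw [hbias, ← Real.norm_eq_abs]
    refine (norm_tsum_le_tsum_norm ?_).trans (le_of_eq ?_)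
    · simpa [abs_mul] using hterm a
    · simp
  have hB' : ∀ a : ZMod n × ZMod n, |bias g (fun i j => x (i, j)) a.1 a.2| ≤ B := fun a =>
    (habs a).trans ((hterm a).tsum_le_tsum
      (fun p => mul_le_of_le_one_right (abs_nonneg _) (hx _ _)) hsa)
  have hB0 : 0 ≤ B := tsum_nonneg fun _ => abs_nonneg _
  rw [← Fintype.sum_prod_type' fun i j => bias g (fun i j => x (i, j)) i j ^ 2]
  calc ∑ a : ZMod n × ZMod n, bias g (fun i j => x (i, j)) a.1 a.2 ^ 2
      ≤ ∑ a : ZMod n × ZMod n, B * ∑' p : ℤ × ℤ, |g p.1 p.2| * |x a - x (a - reduce n p)| := by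
        refine Finset.sum_le_sum fun a _ => ?_
        rw [← sq_abs, sq]
        exact mul_le_mul (hB' a) (habs a) (abs_nonneg _) hB0
    _ = B * ∑' p : ℤ × ℤ, |g p.1 p.2| * shiftVariation x (reduce n p) := by
        rw [← Finset.mul_sum, ← Summable.tsum_finsetSum fun a _ => hterm a]
        simp_rw [← Finset.mul_sum]
        rfl
    _ ≤ _ := by
        refine mul_le_mul_of_nonneg_left ?_ hB0
        rw [← tsum_mul_left]
        have hle : ∀ p : ℤ × ℤ, |g p.1 p.2| * shiftVariation x (reduce n p) ≤
            W * (|g p.1 p.2| * (|(p.1 : ℝ)| + |(p.2 : ℝ)|)) := fun p => by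
          rw [mul_left_comm]
          exact mul_le_mul_of_nonneg_left (shiftVariation_reduce_le h₁ h₂ p) (abs_nonneg _)
        exact (Summable.of_nonneg_of_le
          (fun p => mul_nonneg (abs_nonneg _) (shiftVariation_nonneg x _)) hle
          (hmom.mul_left W)).tsum_le_tsum hle (hmom.mul_left W)

/-- Again a squared `ℓ²` norm bounded by sup norm times `ℓ¹` norm. -/
theorem sum_sq_periodize_le {g : ℤ → ℤ → ℝ} (hg : Summable fun p : ℤ × ℤ => |g p.1 p.2|)
    {n : ℕ} [NeZero n] {U : ℝ}
    (hU : ∀ c, ∑' p : ℤ × ℤ, (if reduce n p = c then |g p.1 p.2| else 0) ≤ U) :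
    ∑ c, periodize g n c ^ 2 ≤ U * ∑' p : ℤ × ℤ, |g p.1 p.2| := by
  have hs : ∀ c, Summable fun p : ℤ × ℤ => if reduce n p = c then |g p.1 p.2| else 0 :=
    fun c => by
      refine (hg.indicator {p | reduce n p = c}).congr fun p => ?_
      simp [Set.indicator_apply]
  have habs : ∀ c, |periodize g n c| ≤
      ∑' p : ℤ × ℤ, if reduce n p = c then |g p.1 p.2| else 0 := by
    intro c
    have he : ∀ p : ℤ × ℤ, ‖if reduce n p = c then g p.1 p.2 else 0‖ =
        if reduce n p = c then |g p.1 p.2| else 0 := fun p => by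
      split_ifs <;> simp
    have h := norm_tsum_le_tsum_norm (f := fun p : ℤ × ℤ => if reduce n p = c then g p.1 p.2 else 0)
      (by simpa only [he] using hs c)
    simp only [he] at h
    exact h
  have htot := tsum_mul_comp_eq_sum hg (reduce n) fun _ => (1 : ℝ)
  simp only [mul_one] at htot
  rw [htot, Finset.mul_sum]
  refine Finset.sum_le_sum fun c _ => ?_
  rw [← sq_abs, sq]
  exact mul_le_mul ((habs c).trans (hU c)) (habs c) (abs_nonneg _)
    (((abs_nonneg _).trans (habs c)).trans (hU c))

theorem risk_le_of_localized {ord : ℝ → ℕ}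
    (hord : ord = (fun a : ℝ => ⌊a⌋₊) ∨ ord = (fun a : ℝ => ⌈a⌉₊ - 1)) {α C : ℝ}
    {f : ℝ × ℝ → ℝ} (hf : f ∈ horizonClass ord α C) (σ : ℝ≥0) {g : ℤ → ℤ → ℝ}
    (hg : HasSum (fun p : ℤ × ℤ => g p.1 p.2) 1)
    (hmom : Summable fun p : ℤ × ℤ => |g p.1 p.2| * (|(p.1 : ℝ)| + |(p.2 : ℝ)|))
    {n : ℕ} [NeZero n] {B D U : ℝ} (hB : ∑' p : ℤ × ℤ, |g p.1 p.2| ≤ B)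
    (hD : ∑' p : ℤ × ℤ, |g p.1 p.2| * (|(p.1 : ℝ)| + |(p.2 : ℝ)|) ≤ D)
    (hU : ∀ c, ∑' p : ℤ × ℤ, (if reduce n p = c then |g p.1 p.2| else 0) ≤ U) :
    risk σ n f g ≤ ENNReal.ofReal (5 * B * D / n + σ ^ 2 * (U * B)) := by
  have hn : (0 : ℝ) < n := by exact_mod_cast Nat.pos_of_neZero n
  obtain ⟨h, ⟨-, hh⟩, rfl⟩ := hf
  obtain ⟨hcont, hreg⟩ := contour_regularity hord hh
  have hB0 : 0 ≤ B := (tsum_nonneg fun _ => abs_nonneg _).trans hB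
  have hU0 : 0 ≤ U := le_trans (tsum_nonneg fun p => by split_ifs <;> positivity) (hU 0)
  rw [risk_eq hg.summable]
  refine ENNReal.ofReal_le_ofReal (add_le_add ?_ ?_)
  · have hpix : pixelAverage n (horizonImage h) = fun i j => cellImage h n (i, j) := by
      ext i j; exact pixelAverage_horizonImage hcont i j
    rw [hpix]
    have h1 := sum_sq_bias_le hg hmom (x := cellImage h n)
      (fun a b => abs_cellAverage_sub_le_one h n _ _ _ _)
      (shiftVariation_cellImage_fst_le hreg n) (shiftVariation_cellImage_snd_le h n)
    have h2 : (∑' p : ℤ × ℤ, |g p.1 p.2|) *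
        (5 * n * ∑' p : ℤ × ℤ, |g p.1 p.2| * (|(p.1 : ℝ)| + |(p.2 : ℝ)|)) ≤
        B * (5 * n * D) := by
      have : 0 ≤ ∑' p : ℤ × ℤ, |g p.1 p.2| * (|(p.1 : ℝ)| + |(p.2 : ℝ)|) :=
        tsum_nonneg fun _ => by positivity
      gcongr
    calc _ ≤ 1 / (n : ℝ) ^ 2 * (B * (5 * n * D)) :=
          mul_le_mul_of_nonneg_left (h1.trans h2) (by positivity)
      _ = _ := by field_simp
  · refine mul_le_mul_of_nonneg_left ?_ (sq_nonneg _)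
    exact (sum_sq_periodize_le hg.summable.abs hU).trans (mul_le_mul_of_nonneg_left hB hU0)

/-! ### Poisson summation for functions supported in the unit square -/

open scoped FourierTransform RealInnerProductSpace

/-- In Poisson summation only the zero translate survives: for `|x| ≤ 1 / 2` and `n ≠ 0`, `|x + n| ≥
1 / 2`. -/
theorem eq_tsum_fourier_of_support {f : ℝ → ℂ} (hc : Continuous f)
    (h0 : ∀ x, 1 / 2 ≤ |x| → f x = 0) (hs : Summable fun n : ℤ => 𝓕 f n) {x : ℝ}
    (hx : |x| ≤ 1 / 2) :
    f x = ∑' n : ℤ, 𝓕 f n * Complex.exp (2 * Real.pi * Complex.I * (n * x)) := by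
  have hO : f =O[Filter.cocompact ℝ] fun x : ℝ => |x| ^ (-(2 : ℝ)) := by
    have hev : f =ᶠ[Filter.cocompact ℝ] fun _ => 0 := by
      filter_upwards [(isCompact_Icc (a := (-(1 / 2) : ℝ)) (b := 1 / 2)).compl_mem_cocompact]
        with y hy
      refine h0 y ?_
      by_contra hlt
      exact hy (abs_le.1 (not_le.1 hlt).le)
    exact hev.trans_isBigO (Asymptotics.isBigO_zero _ _)
  have h := Real.tsum_eq_tsum_fourier_of_rpow_decay_of_summable hc one_lt_two hO hs x
  rw [tsum_eq_single 0] at h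
  · simp only [Int.cast_zero, add_zero] at h
    rw [h]
    refine tsum_congr fun n => ?_
    rw [fourier_coe_apply]
    congr 2
    push_cast
    ring
  · intro n hn
    refine h0 _ ?_
    have h1 : (1 : ℝ) ≤ |(n : ℝ)| := by exact_mod_cast Int.one_le_abs hn
    have h2 : |(n : ℝ)| ≤ |x + n| + |x| := by
      have := abs_sub (x + n) x
      simpa using this
    linarith

/-- The Fourier transform of a function of two real variables, as an iterated transform. -/
def fourierPlane (f : ℝ → ℝ → ℂ) (ξ η : ℝ) : ℂ := 𝓕 (fun y => 𝓕 (fun x => f x y) ξ) η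

theorem continuous_fourier_slice {f : ℝ → ℝ → ℂ} (hc : Continuous f.uncurry)
    (h0 : ∀ x y, 1 / 2 ≤ |x| → f x y = 0) (ξ : ℝ) :
    Continuous fun y => 𝓕 (fun x => f x y) ξ := by
  have h : (fun y => 𝓕 (fun x => f x y) ξ) = fun y =>
      ∫ x in Set.Icc (-(1 / 2) : ℝ) (1 / 2),
        Complex.exp (((-2 * Real.pi * x * ξ : ℝ) : ℂ) * Complex.I) • f x y := by
    ext y
    rw [Real.fourier_real_eq_integral_exp_smul, setIntegral_eq_integral_of_forall_compl_eq_zero]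
    intro x hx
    rw [h0 x y, smul_zero]
    by_contra hlt
    exact hx (abs_le.1 (not_le.1 hlt).le)
  rw [h]
  refine continuous_parametric_integral_of_continuous ?_ isCompact_Icc
  have hc' : Continuous fun p : ℝ × ℝ => f p.2 p.1 := hc.comp continuous_swap
  have hexp : Continuous fun p : ℝ × ℝ =>
      Complex.exp (((-2 * Real.pi * p.2 * ξ : ℝ) : ℂ) * Complex.I) := by fun_prop
  exact hexp.smul hc'

/-- The one-dimensional expansion is used in `x`, and then in `y` for each partial transform. -/
theorem eq_tsum_fourierPlane_of_support {f : ℝ → ℝ → ℂ} (hc : Continuous f.uncurry)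
    (h₁ : ∀ x y, 1 / 2 ≤ |x| → f x y = 0) (h₂ : ∀ x y, 1 / 2 ≤ |y| → f x y = 0)
    (hs : Summable fun p : ℤ × ℤ => fourierPlane f p.1 p.2) {x y : ℝ}
    (hx : |x| ≤ 1 / 2) (hy : |y| ≤ 1 / 2) :
    f x y = ∑' p : ℤ × ℤ, fourierPlane f p.1 p.2 *
      Complex.exp (2 * Real.pi * Complex.I * (p.1 * x + p.2 * y)) := by
  have hslice : ∀ m : ℤ, 𝓕 (fun x => f x y) (m : ℝ) =
      ∑' l : ℤ, fourierPlane f m l * Complex.exp (2 * Real.pi * Complex.I * (l * y)) := by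
    intro m
    refine eq_tsum_fourier_of_support (continuous_fourier_slice hc h₁ m) (fun z hz => ?_)
      (hs.prod_factor m) hy
    rw [Real.fourier_real_eq]
    simp [h₂ _ z hz]
  have hone : ∀ t s : ℝ, ‖Complex.exp (2 * Real.pi * Complex.I * (t * s))‖ = 1 := by
    intro t s
    have : 2 * (Real.pi : ℂ) * Complex.I * (t * s) = ((2 * Real.pi * t * s : ℝ) : ℂ) * Complex.I := by
      push_cast; ring
    rw [this, Complex.norm_exp_ofReal_mul_I]
  have hone' : ∀ (t : ℤ) (s : ℝ), ‖Complex.exp (2 * Real.pi * Complex.I * (t * s))‖ = 1 :=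
    fun t s => by simpa using hone t s
  have hsum : Summable fun p : ℤ × ℤ => fourierPlane f p.1 p.2 *
      Complex.exp (2 * Real.pi * Complex.I * (p.1 * x + p.2 * y)) := by
    refine Summable.of_norm (hs.norm.congr fun p => ?_)
    rw [norm_mul, mul_add, Complex.exp_add, norm_mul, hone', hone', mul_one, mul_one]
  have hrow : Summable fun m : ℤ => 𝓕 (fun x => f x y) (m : ℝ) := by
    refine Summable.of_norm_bounded hs.norm.prod fun m => ?_
    rw [hslice m]
    refine (norm_tsum_le_tsum_norm ?_).trans (le_of_eq ?_)
    · refine (hs.norm.prod_factor m).congr fun l => ?_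
      rw [norm_mul, hone', mul_one]
    · refine tsum_congr fun l => ?_
      rw [norm_mul, hone', mul_one]
  have hcx : Continuous fun x => f x y := hc.comp (Continuous.prodMk_left y)
  rw [eq_tsum_fourier_of_support hcx (fun z hz => h₁ z y hz) hrow hx, hsum.tsum_prod]
  refine tsum_congr fun m => ?_
  rw [hslice m, ← tsum_mul_right]
  refine tsum_congr fun l => ?_
  rw [mul_assoc, ← Complex.exp_add]
  congr 2
  ring

theorem fourier_comp_mul_left (f : ℝ → ℂ) {c : ℝ} (hc : 0 < c) (ξ : ℝ) :
    𝓕 (fun x => f (c * x)) ξ = (c : ℂ)⁻¹ * 𝓕 f (ξ / c) := by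
  rw [Real.fourier_real_eq_integral_exp_smul, Real.fourier_real_eq_integral_exp_smul]
  have h := Measure.integral_comp_mul_left
    (fun x => Complex.exp (((-2 * Real.pi * x * (ξ / c) : ℝ) : ℂ) * Complex.I) • f x) c
  rw [abs_of_pos (inv_pos.2 hc)] at h
  have e : ∀ x : ℝ, -2 * Real.pi * (c * x) * (ξ / c) = -2 * Real.pi * x * ξ := fun x => by
    field_simp
  simp only [e] at h
  rw [h, Complex.real_smul, Complex.ofReal_inv]

theorem fourier_const_mul (c : ℂ) (f : ℝ → ℂ) (ξ : ℝ) :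
    𝓕 (fun x => c * f x) ξ = c * 𝓕 f ξ := by
  rw [Real.fourier_real_eq_integral_exp_smul, Real.fourier_real_eq_integral_exp_smul,
    ← integral_const_mul]
  simp only [smul_eq_mul, mul_left_comm]

theorem fourierPlane_comp_mul_left (f : ℝ → ℝ → ℂ) {c : ℝ} (hc : 0 < c) (ξ η : ℝ) :
    fourierPlane (fun x y => f (c * x) (c * y)) ξ η =
      ((c : ℂ) ^ 2)⁻¹ * fourierPlane f (ξ / c) (η / c) := by
  have h1 : (fun y => 𝓕 (fun x => f (c * x) (c * y)) ξ) =
      fun y => (c : ℂ)⁻¹ * 𝓕 (fun x => f x (c * y)) (ξ / c) := by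
    ext y
    exact fourier_comp_mul_left (fun x => f x (c * y)) hc ξ
  rw [fourierPlane, h1, fourier_const_mul,
    fourier_comp_mul_left (fun z => 𝓕 (fun x => f x z) (ξ / c)) hc, ← mul_assoc, sq, mul_inv]
  rfl

theorem fourier_neg_of_even {f : ℝ → ℂ} (hf : ∀ x, f (-x) = f x) (ξ : ℝ) :
    𝓕 f (-ξ) = 𝓕 f ξ := by
  rw [Real.fourier_real_eq, Real.fourier_real_eq, ← integral_neg_eq_self]
  simp [hf]

theorem conj_fourier_of_even {f : ℝ → ℂ} (hf : ∀ x, f (-x) = f x)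
    (hr : ∀ x, (starRingEnd ℂ) (f x) = f x) (ξ : ℝ) : (starRingEnd ℂ) (𝓕 f ξ) = 𝓕 f ξ := by
  rw [Real.fourier_real_eq_integral_exp_smul, ← integral_conj, ← integral_neg_eq_self]
  refine integral_congr_ae (Filter.Eventually.of_forall fun x => ?_)
  simp only [smul_eq_mul, map_mul, hr, hf, ← Complex.exp_conj, Complex.conj_ofReal, Complex.conj_I]
  congr 2
  push_cast
  ring

theorem fourierPlane_symm {f : ℝ → ℝ → ℂ} (h₁ : ∀ x y, f (-x) y = f x y)
    (h₂ : ∀ x y, f x (-y) = f x y) (hr : ∀ x y, (starRingEnd ℂ) (f x y) = f x y) (ξ η : ℝ) :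
    fourierPlane f (-ξ) η = fourierPlane f ξ η ∧ fourierPlane f ξ (-η) = fourierPlane f ξ η ∧
      (starRingEnd ℂ) (fourierPlane f ξ η) = fourierPlane f ξ η := by
  refine ⟨?_, ?_, ?_⟩
  · have h : (fun y => 𝓕 (fun x => f x y) (-ξ)) = fun y => 𝓕 (fun x => f x y) ξ := by
      ext y
      exact fourier_neg_of_even (fun x => h₁ x y) ξ
    rw [fourierPlane, h, fourierPlane]
  · exact fourier_neg_of_even (fun y => by simp only [h₂]) η
  · exact conj_fourier_of_even (fun y => by simp only [h₂])
      (fun y => conj_fourier_of_even (fun x => h₁ x y) (fun x => hr x y) ξ) η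

theorem fourier_euclidean_eq_fourierPlane {ψ : EuclideanSpace ℝ (Fin 2) → ℂ}
    (hψ : Integrable ψ) (a b : ℝ) :
    𝓕 ψ !₂[a, b] = fourierPlane (fun x y => ψ !₂[x, y]) a b := by
  let e : (ℝ × ℝ) ≃ᵐ EuclideanSpace ℝ (Fin 2) :=
    MeasurableEquiv.finTwoArrow.symm.trans (MeasurableEquiv.toLp 2 (Fin 2 → ℝ))
  have he : MeasurePreserving e :=
    (volume_preserving_finTwoArrow ℝ).symm.trans
      (EuclideanSpace.volume_preserving_symm_measurableEquiv_toLp (Fin 2)).symm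
  have hev : ∀ p : ℝ × ℝ, e p = !₂[p.1, p.2] := fun p => by
    rfl
  have hint : Integrable fun p : ℝ × ℝ =>
      Complex.exp (((-2 * Real.pi * (p.1 * a + p.2 * b) : ℝ) : ℂ) * Complex.I) *
        ψ !₂[p.1, p.2] := by
    have h1 : Integrable fun p : ℝ × ℝ => ψ (e p) := he.integrable_comp_of_integrable hψ
    refine (h1.bdd_mul (c := 1) (by fun_prop) (Filter.Eventually.of_forall fun p => ?_))
    rw [Complex.norm_exp_ofReal_mul_I]
  rw [Real.fourier_eq', ← he.integral_comp e.measurableEmbedding]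
  have h2 : ∀ p : ℝ × ℝ, Complex.exp (((-2 * Real.pi * ⟪e p, !₂[a, b]⟫ : ℝ) : ℂ) * Complex.I) •
      ψ (e p) = Complex.exp (((-2 * Real.pi * (p.1 * a + p.2 * b) : ℝ) : ℂ) * Complex.I) *
        ψ !₂[p.1, p.2] := by
    intro p
    rw [hev, smul_eq_mul]
    congr 5
    simp [PiLp.inner_apply, Fin.sum_univ_two]
    ring
  simp_rw [h2]
  rw [Measure.volume_eq_prod, integral_prod_symm _ hint, fourierPlane,
    Real.fourier_real_eq_integral_exp_smul]
  refine integral_congr_ae (Filter.Eventually.of_forall fun y => ?_)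
  simp only [Real.fourier_real_eq_integral_exp_smul, smul_eq_mul]
  rw [← integral_const_mul]
  refine integral_congr_ae (Filter.Eventually.of_forall fun x => ?_)
  simp only
  rw [← mul_assoc, ← Complex.exp_add]
  congr 2
  push_cast
  ring

/-! ### A radial low-pass profile -/

/-- A smooth radial function on the plane, equal to one at the origin and supported in the disc of
radius `1 / 4`. -/
def radialBump (x y : ℝ) : ℝ := Real.smoothTransition (1 - 16 * (x ^ 2 + y ^ 2))

theorem radialBump_zero : radialBump 0 0 = 1 := by
  simp [radialBump, Real.smoothTransition.one]

theorem radialBump_eq_zero {x y : ℝ} (h : 1 / 4 ≤ |x| ∨ 1 / 4 ≤ |y|) : radialBump x y = 0 := by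
  refine Real.smoothTransition.zero_of_nonpos ?_
  have key : ∀ z : ℝ, 1 / 4 ≤ |z| → 1 / 16 ≤ z ^ 2 := fun z hz => by
    rw [← sq_abs]; nlinarith
  rcases h with h | h
  · nlinarith [key x h, sq_nonneg y]
  · nlinarith [key y h, sq_nonneg x]

theorem continuous_radialBump : Continuous fun p : ℝ × ℝ => radialBump p.1 p.2 :=
  Real.smoothTransition.continuous.comp (by fun_prop)

/-- The Fourier transform of `radialBump`. -/
def bumpTransform (ξ η : ℝ) : ℂ := fourierPlane (fun x y => (radialBump x y : ℂ)) ξ η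

theorem bumpTransform_symm (ξ η : ℝ) :
    bumpTransform (-ξ) η = bumpTransform ξ η ∧ bumpTransform ξ (-η) = bumpTransform ξ η ∧
      (starRingEnd ℂ) (bumpTransform ξ η) = bumpTransform ξ η :=
  fourierPlane_symm (fun x y => by simp [radialBump]) (fun x y => by simp [radialBump])
    (fun x y => Complex.conj_ofReal _) ξ η

open scoped ContDiff in
-- The bump is smooth with compact support, hence Schwartz, and so is its transform. Squared weights
-- are kept in each variable: one factor makes lattice sums converge, the other absorbs a first
-- moment.
theorem exists_bumpTransform_decay : ∃ A : ℝ, 0 < A ∧ ∀ ξ η : ℝ,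
    ‖bumpTransform ξ η‖ ≤ A * (((1 + ξ ^ 2)⁻¹) ^ 2 * ((1 + η ^ 2)⁻¹) ^ 2) := by
  set ψ : EuclideanSpace ℝ (Fin 2) → ℂ := fun v =>
    ((Real.smoothTransition (1 - 16 * ‖v‖ ^ 2) : ℝ) : ℂ) with hψ
  have hsm : ContDiff ℝ ∞ ψ := by
    refine Complex.ofRealCLM.contDiff.comp (Real.smoothTransition.contDiff.comp ?_)
    exact contDiff_const.sub (contDiff_const.mul (contDiff_norm_sq ℝ))
  have hcs : HasCompactSupport ψ := by
    refine HasCompactSupport.intro (isCompact_closedBall 0 (1 / 4)) fun v hv => ?_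
    rw [mem_closedBall_zero_iff, not_le] at hv
    simp only [hψ, Complex.ofReal_eq_zero]
    exact Real.smoothTransition.zero_of_nonpos (by nlinarith)
  set S := hcs.toSchwartzMap hsm with hS
  have hint : Integrable ψ := S.integrable
  obtain ⟨A, hA⟩ : ∃ A : ℝ, ∀ v, (1 + ‖v‖) ^ 8 * ‖𝓕 ψ v‖ ≤ A := by
    have h := SchwartzMap.one_add_le_sup_seminorm_apply (𝕜 := ℝ) (m := (8, 0)) (k := 8) (n := 0)
      le_rfl le_rfl (𝓕 S)
    simp only [norm_iteratedFDeriv_zero] at h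
    exact ⟨_, h⟩
  have hrad : ∀ x y : ℝ, ψ !₂[x, y] = (radialBump x y : ℂ) := fun x y => by
    simp [hψ, radialBump, EuclideanSpace.real_norm_sq_eq, Fin.sum_univ_two]
  refine ⟨|A| + 1, by positivity, fun ξ η => ?_⟩
  have h1 : 𝓕 ψ !₂[ξ, η] = bumpTransform ξ η := by
    rw [fourier_euclidean_eq_fourierPlane hint, bumpTransform]
    simp_rw [hrad]
  have h2 := hA !₂[ξ, η]
  rw [h1] at h2
  set r := ‖(!₂[ξ, η] : EuclideanSpace ℝ (Fin 2))‖ with hr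
  have hr0 : 0 ≤ r := norm_nonneg _
  have hr2 : r ^ 2 = ξ ^ 2 + η ^ 2 := by
    rw [hr, EuclideanSpace.real_norm_sq_eq]; simp [Fin.sum_univ_two]
  have h3 : (1 + ξ ^ 2) ^ 2 * (1 + η ^ 2) ^ 2 ≤ (1 + r) ^ 8 := by
    have e1 : 1 + ξ ^ 2 ≤ (1 + r) ^ 2 := by nlinarith [sq_nonneg η]
    have e2 : 1 + η ^ 2 ≤ (1 + r) ^ 2 := by nlinarith [sq_nonneg ξ]
    calc (1 + ξ ^ 2) ^ 2 * (1 + η ^ 2) ^ 2 ≤ ((1 + r) ^ 2) ^ 2 * ((1 + r) ^ 2) ^ 2 := by gcongr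
      _ = (1 + r) ^ 8 := by ring
  rw [inv_pow, inv_pow, ← mul_inv, ← div_eq_mul_inv, le_div_iff₀ (by positivity), mul_comm]
  calc (1 + ξ ^ 2) ^ 2 * (1 + η ^ 2) ^ 2 * ‖bumpTransform ξ η‖
      ≤ (1 + r) ^ 8 * ‖bumpTransform ξ η‖ := by gcongr
    _ ≤ A := h2
    _ ≤ |A| + 1 := by linarith [le_abs_self A]

/-! ### Lattice sums -/

/-- The weight `1 / (1 + (m / N)²)`. -/
def latticeWeight (N : ℕ) (m : ℤ) : ℝ := (1 + ((m : ℝ) / N) ^ 2)⁻¹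

theorem latticeWeight_pos (N : ℕ) (m : ℤ) : 0 < latticeWeight N m := by
  unfold latticeWeight; positivity

theorem latticeWeight_le_one (N : ℕ) (m : ℤ) : latticeWeight N m ≤ 1 :=
  inv_le_one_of_one_le₀ (by nlinarith [sq_nonneg ((m : ℝ) / N)])

theorem abs_mul_latticeWeight_le {N : ℕ} (hN : 0 < N) (m : ℤ) :
    |(m : ℝ)| * latticeWeight N m ≤ N := by
  have hN' : (0 : ℝ) < N := by exact_mod_cast hN
  unfold latticeWeight
  rw [← div_eq_mul_inv, div_le_iff₀ (by positivity), div_pow, mul_add, mul_one, sq (N : ℝ),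
    mul_div_assoc', mul_div_mul_left _ _ hN'.ne', ← sq_abs (m : ℝ)]
  have h : |(m : ℝ)| * N ≤ N * N + |(m : ℝ)| ^ 2 := by
    nlinarith [sq_nonneg (|(m : ℝ)| - N), abs_nonneg (m : ℝ)]
  calc |(m : ℝ)| = |(m : ℝ)| * N / N := by field_simp
    _ ≤ (N * N + |(m : ℝ)| ^ 2) / N := by gcongr
    _ = N + |(m : ℝ)| ^ 2 / N := by field_simp

theorem summable_inv_one_add_sq : Summable fun r : ℤ => 4 * (1 + (r : ℝ) ^ 2)⁻¹ := by
  refine Summable.mul_left _ ?_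
  have h1 : Summable fun r : ℤ => 1 / (r : ℝ) ^ 2 := Real.summable_one_div_int_pow.2 one_lt_two
  have h2 : Summable fun r : ℤ => if r = 0 then (1 : ℝ) else 0 :=
    (hasSum_ite_eq (0 : ℤ) (1 : ℝ)).summable
  refine Summable.of_nonneg_of_le (fun r => by positivity) (fun r => ?_) (h1.add h2)
  by_cases hr : r = 0
  · simp [hr]
  · have : (0 : ℝ) < (r : ℝ) ^ 2 := by positivity
    rw [if_neg hr, add_zero, one_div]
    exact inv_anti₀ this (by linarith)

/-- A bound for the sum of `latticeWeight N` over a residue class of modulus at least `N`. -/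
def residueBound : ℝ := ∑' r : ℤ, 4 * (1 + (r : ℝ) ^ 2)⁻¹

theorem residueBound_pos : 0 < residueBound :=
  summable_inv_one_add_sq.tsum_pos (fun r => by positivity) 0 (by positivity)

/-- From `a < n` and `N ≤ n`, `|a + n r| / N ≥ |r| - 1`. The factor 4 absorbs the `-1`, making the
bound uniform in `N`, `n` and `a`. -/
theorem latticeWeight_residue_le {N n : ℕ} (hN : 0 < N) (hNn : N ≤ n) {a : ℕ} (ha : a < n)
    (r : ℤ) : latticeWeight N (a + n * r) ≤ 4 * (1 + (r : ℝ) ^ 2)⁻¹ := by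
  by_cases hr : r = 0
  · refine (latticeWeight_le_one _ _).trans ?_
    simp [hr]
  have hN' : (0 : ℝ) < N := by exact_mod_cast hN
  have hNn' : (N : ℝ) ≤ n := by exact_mod_cast hNn
  have ha' : (a : ℝ) ≤ n := by exact_mod_cast ha.le
  have hr1 : (1 : ℝ) ≤ |(r : ℝ)| := by exact_mod_cast Int.one_le_abs hr
  have h1 : |(r : ℝ)| - 1 ≤ |((a + n * r : ℤ) : ℝ) / N| := by
    rw [abs_div, abs_of_pos hN', le_div_iff₀ hN']
    have h2 : (n : ℝ) * |(r : ℝ)| - a ≤ |((a + n * r : ℤ) : ℝ)| := by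
      have := abs_sub ((a + n * r : ℤ) : ℝ) (a : ℝ)
      push_cast at this ⊢
      rw [add_sub_cancel_left, abs_mul, Nat.abs_cast, Nat.abs_cast] at this
      linarith
    nlinarith
  unfold latticeWeight
  rw [← sq_abs (((a + n * r : ℤ) : ℝ) / N), ← sq_abs (r : ℝ), ← div_eq_mul_inv,
    inv_le_comm₀ (by positivity) (by positivity), inv_div]
  nlinarith [mul_self_le_mul_self (by linarith : (0 : ℝ) ≤ |(r : ℝ)| - 1) h1,
    sq_nonneg (3 * |(r : ℝ)| - 4)]

theorem sum_residue_latticeWeight {N n : ℕ} (hN : 0 < N) (hNn : N ≤ n) [NeZero n] (a : ZMod n) :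
    (Summable fun m : ℤ => if (m : ZMod n) = a then latticeWeight N m else 0) ∧
      ∑' m : ℤ, (if (m : ZMod n) = a then latticeWeight N m else 0) ≤ residueBound := by
  have hinj : Function.Injective fun r : ℤ => (a.val : ℤ) + n * r := fun r s h => by
    simpa [NeZero.ne n] using h
  have hsupp : (Function.support fun m : ℤ => if (m : ZMod n) = a then latticeWeight N m else 0) ⊆
      Set.range fun r : ℤ => (a.val : ℤ) + n * r := by
    intro m hm
    have hma : (m : ZMod n) = a := by
      by_contra hne
      exact hm (if_neg hne)
    have : ((a.val : ℤ) : ZMod n) = (m : ZMod n) := by rw [hma]; simp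
    rw [ZMod.intCast_eq_intCast_iff_dvd_sub] at this
    obtain ⟨r, hr⟩ := this
    exact ⟨r, by simp only; linarith⟩
  have hcomp : ∀ r : ℤ, (if (((a.val : ℤ) + n * r : ℤ) : ZMod n) = a then
      latticeWeight N ((a.val : ℤ) + n * r) else 0) = latticeWeight N ((a.val : ℤ) + n * r) :=
    fun r => if_pos (by simp)
  have hle := fun r : ℤ => latticeWeight_residue_le hN hNn (ZMod.val_lt a) r
  have hsr : Summable fun r : ℤ => latticeWeight N ((a.val : ℤ) + n * r) :=
    Summable.of_nonneg_of_le (fun r => (latticeWeight_pos _ _).le) hle summable_inv_one_add_sq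
  constructor
  · rw [← hinj.summable_iff fun m hm => Function.notMem_support.1 fun h => hm (hsupp h)]
    exact hsr.congr fun r => (hcomp r).symm
  · rw [← hinj.tsum_eq hsupp]
    simp_rw [hcomp]
    exact hsr.tsum_le_tsum hle summable_inv_one_add_sq

/-- Split `ℤ` into its `N` residue classes modulo `N` and bound each class. -/
theorem sum_latticeWeight {N : ℕ} (hN : 0 < N) :
    Summable (latticeWeight N) ∧ ∑' m, latticeWeight N m ≤ N * residueBound := by
  have : NeZero N := ⟨hN.ne'⟩
  have h := fun a : ZMod N => sum_residue_latticeWeight hN le_rfl a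
  have he : ∀ m : ℤ, ∑ a : ZMod N, (if (m : ZMod N) = a then latticeWeight N m else 0) =
      latticeWeight N m := fun m => by simp
  have hs : Summable (latticeWeight N) :=
    (summable_sum fun a (_ : a ∈ Finset.univ) => (h a).1).congr fun m => he m
  refine ⟨hs, ?_⟩
  have htot : ∑' m, latticeWeight N m = ∑ a : ZMod N,
      ∑' m : ℤ, (if (m : ZMod N) = a then latticeWeight N m else 0) := by
    rw [← Summable.tsum_finsetSum fun a _ => (h a).1]
    exact tsum_congr fun m => (he m).symm
  rw [htot]
  refine (Finset.sum_le_sum fun a _ => (h a).2).trans ?_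
  simp [ZMod.card]

/-! ### Regularity of the transfer function -/

theorem norm_transferTerm_sub_le (c : ℝ) (p : ℤ × ℤ) (ω ω' : ℝ × ℝ) :
    ‖(c : ℂ) * Complex.exp (-Complex.I * ((p.1 : ℂ) * (ω.1 : ℂ) + (p.2 : ℂ) * (ω.2 : ℂ))) -
      (c : ℂ) * Complex.exp (-Complex.I * ((p.1 : ℂ) * (ω'.1 : ℂ) + (p.2 : ℂ) * (ω'.2 : ℂ)))‖ ≤
      |c| * (|(p.1 : ℝ)| * |ω.1 - ω'.1| + |(p.2 : ℝ)| * |ω.2 - ω'.2|) := by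
  have he : ∀ ω : ℝ × ℝ, -Complex.I * ((p.1 : ℂ) * (ω.1 : ℂ) + (p.2 : ℂ) * (ω.2 : ℂ)) =
      Complex.I * ((-(p.1 * ω.1 + p.2 * ω.2) : ℝ) : ℂ) := fun ω => by push_cast; ring
  rw [← mul_sub, norm_mul, Complex.norm_real, Real.norm_eq_abs, he, he]
  refine mul_le_mul_of_nonneg_left ?_ (abs_nonneg _)
  set s : ℝ := -(p.1 * ω.1 + p.2 * ω.2)
  set t : ℝ := -(p.1 * ω'.1 + p.2 * ω'.2)
  have h1 : Complex.exp (Complex.I * s) - Complex.exp (Complex.I * t) =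
      Complex.exp (Complex.I * t) * (Complex.exp (Complex.I * ((s - t : ℝ) : ℂ)) - 1) := by
    rw [mul_sub, ← Complex.exp_add, mul_one]
    congr 2
    push_cast
    ring
  rw [h1, norm_mul, Complex.norm_exp_I_mul_ofReal, one_mul]
  refine Real.norm_exp_I_mul_ofReal_sub_one_le.trans ?_
  have h2 : s - t = -((p.1 : ℝ) * (ω.1 - ω'.1) + (p.2 : ℝ) * (ω.2 - ω'.2)) := by
    simp only [s, t]; ring
  rw [h2, norm_neg, Real.norm_eq_abs]
  refine (abs_add_le _ _).trans (le_of_eq ?_)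
  rw [abs_mul, abs_mul]

theorem summable_transferTerm {g : ℤ → ℤ → ℝ} (hg : Summable fun p : ℤ × ℤ => g p.1 p.2)
    (ω₁ ω₂ : ℝ) : Summable fun p : ℤ × ℤ => (g p.1 p.2 : ℂ) *
      Complex.exp (-Complex.I * ((p.1 : ℂ) * (ω₁ : ℂ) + (p.2 : ℂ) * (ω₂ : ℂ))) := by
  refine Summable.of_norm (hg.abs.congr fun p => ?_)
  have he : -Complex.I * ((p.1 : ℂ) * (ω₁ : ℂ) + (p.2 : ℂ) * (ω₂ : ℂ)) =
      Complex.I * ((-(p.1 * ω₁ + p.2 * ω₂) : ℝ) : ℂ) := by push_cast; ring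
  rw [norm_mul, Complex.norm_real, he, Complex.norm_exp_I_mul_ofReal, mul_one, Real.norm_eq_abs]

theorem norm_fourierTransform_sub_le {g : ℤ → ℤ → ℝ}
    (hg : Summable fun p : ℤ × ℤ => g p.1 p.2)
    (hmom : Summable fun p : ℤ × ℤ => |g p.1 p.2| * (|(p.1 : ℝ)| + |(p.2 : ℝ)|))
    (ω ω' : ℝ × ℝ) :
    ‖fourierTransform g ω.1 ω.2 - fourierTransform g ω'.1 ω'.2‖ ≤
      (∑' p : ℤ × ℤ, |g p.1 p.2| * (|(p.1 : ℝ)| + |(p.2 : ℝ)|)) * ‖ω - ω'‖ := by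
  rw [fourierTransform, fourierTransform,
    ← (summable_transferTerm hg ω.1 ω.2).tsum_sub (summable_transferTerm hg ω'.1 ω'.2),
    ← tsum_mul_right]
  refine tsum_of_norm_bounded (hmom.mul_right _).hasSum fun p => ?_
  refine (norm_transferTerm_sub_le _ p ω ω').trans ?_
  have h1 : |ω.1 - ω'.1| ≤ ‖ω - ω'‖ := norm_fst_le (ω - ω')
  have h2 : |ω.2 - ω'.2| ≤ ‖ω - ω'‖ := norm_snd_le (ω - ω')
  calc |g p.1 p.2| * (|(p.1 : ℝ)| * |ω.1 - ω'.1| + |(p.2 : ℝ)| * |ω.2 - ω'.2|)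
      ≤ |g p.1 p.2| * (|(p.1 : ℝ)| * ‖ω - ω'‖ + |(p.2 : ℝ)| * ‖ω - ω'‖) := by gcongr
    _ = _ := by ring

/-- Termwise differentiation: the first-moment series dominates the derivatives of the terms. -/
theorem differentiable_fourierTransform {g : ℤ → ℤ → ℝ}
    (hmom : Summable fun p : ℤ × ℤ => |g p.1 p.2| * (|(p.1 : ℝ)| + |(p.2 : ℝ)|)) :
    Differentiable ℝ fun ω : ℝ × ℝ => fourierTransform g ω.1 ω.2 := by
  unfold fourierTransform
  have hd : ∀ p : ℤ × ℤ, Differentiable ℝ fun ω : ℝ × ℝ => (g p.1 p.2 : ℂ) *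
      Complex.exp (-Complex.I * ((p.1 : ℂ) * (ω.1 : ℂ) + (p.2 : ℂ) * (ω.2 : ℂ))) := by
    intro p
    have h1 : Differentiable ℝ fun ω : ℝ × ℝ => (ω.1 : ℂ) :=
      Complex.ofRealCLM.differentiable.comp differentiable_fst
    have h2 : Differentiable ℝ fun ω : ℝ × ℝ => (ω.2 : ℂ) :=
      Complex.ofRealCLM.differentiable.comp differentiable_snd
    exact ((((h1.const_mul _).add (h2.const_mul _)).const_mul _).cexp).const_mul _
  refine differentiable_tsum hmom (fun p ω => (hd p ω).hasFDerivAt) fun p ω => ?_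
  refine norm_fderiv_le_of_lip' ℝ (by positivity) (Filter.Eventually.of_forall fun ω' => ?_)
  refine (norm_transferTerm_sub_le _ p ω' ω).trans ?_
  have h1 : |ω'.1 - ω.1| ≤ ‖ω' - ω‖ := norm_fst_le (ω' - ω)
  have h2 : |ω'.2 - ω.2| ≤ ‖ω' - ω‖ := norm_snd_le (ω' - ω)
  calc |g p.1 p.2| * (|(p.1 : ℝ)| * |ω'.1 - ω.1| + |(p.2 : ℝ)| * |ω'.2 - ω.2|)
      ≤ |g p.1 p.2| * (|(p.1 : ℝ)| * ‖ω' - ω‖ + |(p.2 : ℝ)| * ‖ω' - ω‖) := by gcongr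
    _ = _ := by ring

theorem exists_gradNorm_le {g : ℤ → ℤ → ℝ}
    (hg : Summable fun p : ℤ × ℤ => g p.1 p.2)
    (hmom : Summable fun p : ℤ × ℤ => |g p.1 p.2| * (|(p.1 : ℝ)| + |(p.2 : ℝ)|)) :
    ∃ D : ℝ, ∀ ω₁ ω₂ : ℝ, gradNorm g ω₁ ω₂ ≤ D := by
  set D := ∑' p : ℤ × ℤ, |g p.1 p.2| * (|(p.1 : ℝ)| + |(p.2 : ℝ)|) with hD
  have hD0 : 0 ≤ D := tsum_nonneg fun _ => by positivity
  have hlip := norm_fourierTransform_sub_le hg hmom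
  refine ⟨Real.sqrt (D ^ 2 + D ^ 2), fun ω₁ ω₂ => Real.sqrt_le_sqrt (add_le_add ?_ ?_)⟩
  · refine pow_le_pow_left₀ (norm_nonneg _) (norm_deriv_le_of_lip' hD0
      (Filter.Eventually.of_forall fun t => ?_)) 2
    simpa [Prod.norm_def] using hlip (t, ω₂) (ω₁, ω₂)
  · refine pow_le_pow_left₀ (norm_nonneg _) (norm_deriv_le_of_lip' hD0
      (Filter.Eventually.of_forall fun t => ?_)) 2
    simpa [Prod.norm_def] using hlip (ω₁, t) (ω₁, ω₂)

/-! ### The low-pass filters -/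

/-- The filter whose transfer function is `radialBump` contracted by the factor `N`. -/
def lowPass (N : ℕ) (m l : ℤ) : ℝ := ((N : ℝ) ^ 2)⁻¹ * (bumpTransform (m / N) (l / N)).re

theorem ofReal_lowPass {N : ℕ} (hN : 0 < N) (m l : ℤ) : (lowPass N m l : ℂ) =
    fourierPlane (fun x y => (radialBump (N * x) (N * y) : ℂ)) m l := by
  have hN' : (0 : ℝ) < N := by exact_mod_cast hN
  rw [fourierPlane_comp_mul_left (fun x y => (radialBump x y : ℂ)) hN', lowPass]
  have h := Complex.conj_eq_iff_re.1 (bumpTransform_symm (m / N) (l / N)).2.2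
  push_cast
  rw [h]
  rfl

/-- The weights that dominate the low-pass filters. -/
def planeWeight (N : ℕ) (p : ℤ × ℤ) : ℝ := latticeWeight N p.1 * latticeWeight N p.2

theorem sum_planeWeight {N : ℕ} (hN : 0 < N) : Summable (planeWeight N) ∧
    ∑' p, planeWeight N p ≤ (N : ℝ) ^ 2 * residueBound ^ 2 := by
  obtain ⟨hs, hle⟩ := sum_latticeWeight hN
  have hprod := hs.mul_of_nonneg hs (fun m => (latticeWeight_pos N m).le)
    (fun m => (latticeWeight_pos N m).le)
  refine ⟨hprod, ?_⟩
  have h := hs.tsum_mul_tsum hs hprod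
  have h0 : 0 ≤ ∑' m, latticeWeight N m := tsum_nonneg fun m => (latticeWeight_pos N m).le
  calc ∑' p, planeWeight N p = (∑' m, latticeWeight N m) * ∑' m, latticeWeight N m := h.symm
    _ ≤ (N * residueBound) * (N * residueBound) := mul_le_mul hle hle h0 (h0.trans hle)
    _ = _ := by ring

theorem sum_residue_planeWeight {N n : ℕ} (hN : 0 < N) (hNn : N ≤ n) [NeZero n]
    (c : ZMod n × ZMod n) :
    (Summable fun p => if reduce n p = c then planeWeight N p else 0) ∧
      ∑' p, (if reduce n p = c then planeWeight N p else 0) ≤ residueBound ^ 2 := by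
  obtain ⟨hs₁, hle₁⟩ := sum_residue_latticeWeight hN hNn c.1
  obtain ⟨hs₂, hle₂⟩ := sum_residue_latticeWeight hN hNn c.2
  have h0 : ∀ (a : ZMod n) (m : ℤ), 0 ≤ if (m : ZMod n) = a then latticeWeight N m else 0 :=
    fun a m => by
      split_ifs
      exacts [(latticeWeight_pos N m).le, le_rfl]
  have hprod := hs₁.mul_of_nonneg hs₂ (h0 c.1) (h0 c.2)
  have he : ∀ p : ℤ × ℤ, (if reduce n p = c then planeWeight N p else 0) =
      (if (p.1 : ZMod n) = c.1 then latticeWeight N p.1 else 0) *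
        (if (p.2 : ZMod n) = c.2 then latticeWeight N p.2 else 0) := by
    intro p
    by_cases h1 : (p.1 : ZMod n) = c.1 <;> by_cases h2 : (p.2 : ZMod n) = c.2 <;>
      simp [reduce, planeWeight, Prod.ext_iff, h1, h2]
  simp_rw [he]
  refine ⟨hprod, ?_⟩
  rw [← hs₁.tsum_mul_tsum hs₂ hprod, sq]
  exact mul_le_mul hle₁ hle₂ (tsum_nonneg (h0 c.2)) residueBound_pos.le

/-- The decay constant of `bumpTransform`. -/
def decayConst : ℝ := exists_bumpTransform_decay.choose

theorem decayConst_pos : 0 < decayConst := exists_bumpTransform_decay.choose_spec.1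

theorem abs_lowPass_le (N : ℕ) (p : ℤ × ℤ) : |lowPass N p.1 p.2| ≤
    decayConst / (N : ℝ) ^ 2 * (latticeWeight N p.1 ^ 2 * latticeWeight N p.2 ^ 2) := by
  rw [lowPass, abs_mul, abs_of_nonneg (by positivity), div_eq_inv_mul decayConst, mul_assoc]
  exact mul_le_mul_of_nonneg_left ((Complex.abs_re_le_norm _).trans
    (exists_bumpTransform_decay.choose_spec.2 _ _)) (by positivity)

theorem abs_lowPass_le_planeWeight (N : ℕ) (p : ℤ × ℤ) :
    |lowPass N p.1 p.2| ≤ decayConst / (N : ℝ) ^ 2 * planeWeight N p := by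
  refine (abs_lowPass_le N p).trans (mul_le_mul_of_nonneg_left ?_
    (div_nonneg decayConst_pos.le (by positivity)))
  have h := fun m => pow_le_of_le_one (latticeWeight_pos N m).le (latticeWeight_le_one N m)
    two_ne_zero
  exact mul_le_mul (h _) (h _) (by positivity) (latticeWeight_pos _ _).le

/-- One of the two weight factors absorbs `|p|` at the price of a factor `N`; the other remains for
summation. -/
theorem abs_lowPass_mul_le {N : ℕ} (hN : 0 < N) (p : ℤ × ℤ) :
    |lowPass N p.1 p.2| * (|(p.1 : ℝ)| + |(p.2 : ℝ)|) ≤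
      2 * decayConst / N * planeWeight N p := by
  have hN' : (0 : ℝ) < N := by exact_mod_cast hN
  have hA := decayConst_pos
  set u := latticeWeight N p.1 with hu
  set v := latticeWeight N p.2 with hv
  have hu0 : 0 < u := latticeWeight_pos _ _
  have hv0 : 0 < v := latticeWeight_pos _ _
  have hu1 : u ≤ 1 := latticeWeight_le_one _ _
  have hv1 : v ≤ 1 := latticeWeight_le_one _ _
  have h1 : |(p.1 : ℝ)| * u ≤ N := abs_mul_latticeWeight_le hN p.1
  have h2 : |(p.2 : ℝ)| * v ≤ N := abs_mul_latticeWeight_le hN p.2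
  calc |lowPass N p.1 p.2| * (|(p.1 : ℝ)| + |(p.2 : ℝ)|)
      ≤ decayConst / (N : ℝ) ^ 2 * (u ^ 2 * v ^ 2) * (|(p.1 : ℝ)| + |(p.2 : ℝ)|) :=
        mul_le_mul_of_nonneg_right (abs_lowPass_le N p) (by positivity)
    _ = decayConst / (N : ℝ) ^ 2 * (u * v * ((|(p.1 : ℝ)| * u) * v + (|(p.2 : ℝ)| * v) * u)) := by
        ring
    _ ≤ decayConst / (N : ℝ) ^ 2 * (u * v * (N * 1 + N * 1)) := by gcongr
    _ = 2 * decayConst / N * (u * v) := by field_simp; ring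

theorem summable_abs_lowPass {N : ℕ} (hN : 0 < N) :
    Summable fun p : ℤ × ℤ => |lowPass N p.1 p.2| :=
  Summable.of_nonneg_of_le (fun _ => abs_nonneg _) (abs_lowPass_le_planeWeight N)
    ((sum_planeWeight hN).1.mul_left _)

theorem summable_moment_lowPass {N : ℕ} (hN : 0 < N) :
    Summable fun p : ℤ × ℤ => |lowPass N p.1 p.2| * (|(p.1 : ℝ)| + |(p.2 : ℝ)|) :=
  Summable.of_nonneg_of_le (fun _ => by positivity) (abs_lowPass_mul_le hN)
    ((sum_planeWeight hN).1.mul_left _)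

theorem tsum_abs_lowPass_le {N : ℕ} (hN : 0 < N) :
    ∑' p : ℤ × ℤ, |lowPass N p.1 p.2| ≤ decayConst * residueBound ^ 2 := by
  have hN' : (0 : ℝ) < N := by exact_mod_cast hN
  have hA := decayConst_pos
  obtain ⟨hs, hle⟩ := sum_planeWeight hN
  refine ((summable_abs_lowPass hN).tsum_le_tsum (abs_lowPass_le_planeWeight N)
    (hs.mul_left _)).trans ?_
  rw [tsum_mul_left]
  calc _ ≤ decayConst / (N : ℝ) ^ 2 * ((N : ℝ) ^ 2 * residueBound ^ 2) := by gcongr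
    _ = _ := by field_simp

theorem tsum_moment_lowPass_le {N : ℕ} (hN : 0 < N) :
    ∑' p : ℤ × ℤ, |lowPass N p.1 p.2| * (|(p.1 : ℝ)| + |(p.2 : ℝ)|) ≤
      2 * decayConst * residueBound ^ 2 * N := by
  have hN' : (0 : ℝ) < N := by exact_mod_cast hN
  have hA := decayConst_pos
  obtain ⟨hs, hle⟩ := sum_planeWeight hN
  refine ((summable_moment_lowPass hN).tsum_le_tsum (abs_lowPass_mul_le hN)
    (hs.mul_left _)).trans ?_
  rw [tsum_mul_left]
  calc _ ≤ 2 * decayConst / N * ((N : ℝ) ^ 2 * residueBound ^ 2) := by gcongr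
    _ = _ := by field_simp

theorem tsum_residue_lowPass_le {N n : ℕ} (hN : 0 < N) (hNn : N ≤ n) [NeZero n]
    (c : ZMod n × ZMod n) :
    ∑' p : ℤ × ℤ, (if reduce n p = c then |lowPass N p.1 p.2| else 0) ≤
      decayConst * residueBound ^ 2 / (N : ℝ) ^ 2 := by
  have hN' : (0 : ℝ) < N := by exact_mod_cast hN
  have hA := decayConst_pos
  obtain ⟨hs, hle⟩ := sum_residue_planeWeight hN hNn c
  have hterm : ∀ p : ℤ × ℤ, (if reduce n p = c then |lowPass N p.1 p.2| else 0) ≤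
      decayConst / (N : ℝ) ^ 2 * if reduce n p = c then planeWeight N p else 0 := fun p => by
    split_ifs
    · exact abs_lowPass_le_planeWeight N p
    · simp
  refine ((Summable.of_nonneg_of_le (fun p => by split_ifs <;> positivity) hterm
    (hs.mul_left _)).tsum_le_tsum hterm (hs.mul_left _)).trans ?_
  rw [tsum_mul_left]
  calc _ ≤ decayConst / (N : ℝ) ^ 2 * residueBound ^ 2 := by gcongr
    _ = _ := by ring

/-- Poisson summation at the point `-ω / (2 π)`, which lies in the square `|x|, |y| ≤ 1 / 2`. The
contracted bump is supported in a disc of radius at most `1 / 4`, so there is no aliasing. -/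
theorem fourierTransform_lowPass {N : ℕ} (hN : 0 < N) {ω₁ ω₂ : ℝ} (h₁ : |ω₁| ≤ Real.pi)
    (h₂ : |ω₂| ≤ Real.pi) : fourierTransform (lowPass N) ω₁ ω₂ =
      (radialBump (N * (-ω₁ / (2 * Real.pi))) (N * (-ω₂ / (2 * Real.pi))) : ℂ) := by
  have hN' : (1 : ℝ) ≤ N := by exact_mod_cast hN
  have hscale : ∀ z : ℝ, 1 / 2 ≤ |z| → 1 / 4 ≤ |(N : ℝ) * z| := fun z hz => by
    rw [abs_mul, Nat.abs_cast]; nlinarith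
  have hhalf : ∀ ω : ℝ, |ω| ≤ Real.pi → |-ω / (2 * Real.pi)| ≤ 1 / 2 := fun ω h => by
    rw [abs_div, abs_neg, abs_of_pos Real.two_pi_pos, div_le_iff₀ Real.two_pi_pos]
    linarith
  have hpi : (Real.pi : ℂ) ≠ 0 := by exact_mod_cast Real.pi_ne_zero
  have hcont : Continuous (Function.uncurry fun x y : ℝ =>
      (radialBump (N * x) (N * y) : ℂ)) :=
    Complex.continuous_ofReal.comp (continuous_radialBump.comp
      (by fun_prop : Continuous fun p : ℝ × ℝ => ((N : ℝ) * p.1, (N : ℝ) * p.2)))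
  have hs : Summable fun p : ℤ × ℤ =>
      fourierPlane (fun x y => (radialBump (N * x) (N * y) : ℂ)) p.1 p.2 := by
    simp_rw [← ofReal_lowPass hN]
    exact Complex.summable_ofReal.2 (summable_abs_lowPass hN).of_abs
  have h := eq_tsum_fourierPlane_of_support hcont
    (fun x y hx => by rw [radialBump_eq_zero (Or.inl (hscale x hx)), Complex.ofReal_zero])
    (fun x y hy => by rw [radialBump_eq_zero (Or.inr (hscale y hy)), Complex.ofReal_zero])
    hs (hhalf ω₁ h₁) (hhalf ω₂ h₂)
  rw [h, fourierTransform]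
  refine tsum_congr fun p => ?_
  rw [ofReal_lowPass hN]
  congr 2
  push_cast
  field_simp
  ring

theorem isAdmissible_lowPass {N : ℕ} (hN : 0 < N) : IsAdmissible (lowPass N) where
  hasSum_one := by
    have hs : Summable fun p : ℤ × ℤ => lowPass N p.1 p.2 := (summable_abs_lowPass hN).of_abs
    -- The total mass is the transfer function at frequency zero, where the bump equals 1.
    have h := fourierTransform_lowPass hN (ω₁ := 0) (ω₂ := 0)
      (by simpa using Real.pi_pos.le) (by simpa using Real.pi_pos.le)
    have h1 : fourierTransform (lowPass N) 0 0 = ((∑' p : ℤ × ℤ, lowPass N p.1 p.2 : ℝ) : ℂ) := by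
      rw [fourierTransform, Complex.ofReal_tsum]
      simp
    rw [h1] at h
    simp only [neg_zero, zero_div, mul_zero, radialBump_zero] at h
    have h2 : ∑' p : ℤ × ℤ, lowPass N p.1 p.2 = 1 := by exact_mod_cast h
    exact h2 ▸ hs.hasSum
  symm_fst i j := by
    rw [lowPass, lowPass, Int.cast_neg, neg_div, (bumpTransform_symm _ _).1]
  symm_snd i j := by
    rw [lowPass, lowPass, Int.cast_neg, neg_div, (bumpTransform_symm _ _).2.1]
  isotropic := by
    refine ⟨fun r => (radialBump (N * (r / (2 * Real.pi))) 0 : ℂ), fun ω₁ ω₂ h1 h2 h3 h4 => ?_⟩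
    rw [fourierTransform_lowPass hN (abs_le.2 ⟨h1.le, h2⟩) (abs_le.2 ⟨h3.le, h4⟩)]
    congr 1
    simp only [radialBump, mul_pow, div_pow, neg_sq,
      Real.sq_sqrt (add_nonneg (sq_nonneg ω₁) (sq_nonneg ω₂))]
    congr 1
    ring
  differentiable := differentiable_fourierTransform (summable_moment_lowPass hN)
  bounded_grad := exists_gradNorm_le (summable_abs_lowPass hN).of_abs (summable_moment_lowPass hN)

/-! ### The upper bound -/

theorem exists_minimaxRisk_le {ord : ℝ → ℕ}
    (hord : ord = (fun a : ℝ => ⌊a⌋₊) ∨ ord = (fun a : ℝ => ⌈a⌉₊ - 1))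
    (α C : ℝ) (σ : ℝ≥0) :
    ∃ c : ℝ, 0 < c ∧ ∀ (n : ℕ) [NeZero n],
      minimaxRisk ord α C σ n ≤ ENNReal.ofReal (c * (n : ℝ) ^ (-(2 / 3) : ℝ)) := by
  have hA := decayConst_pos
  have hR := residueBound_pos
  set A := decayConst * residueBound ^ 2 with hAdef
  have hA0 : 0 < A := by positivity
  refine ⟨A ^ 2 * (20 + σ ^ 2), by positivity, fun n _ => ?_⟩
  have hn1 : (1 : ℝ) ≤ n := by exact_mod_cast Nat.pos_of_neZero n
  have hn0 : (0 : ℝ) < n := by linarith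
  set y : ℝ := (n : ℝ) ^ (1 / 3 : ℝ) with hy
  have hy1 : 1 ≤ y := Real.one_le_rpow hn1 (by norm_num)
  have hy0 : 0 < y := by linarith
  have hy3 : y ^ 3 = n := by
    rw [hy, ← Real.rpow_natCast, ← Real.rpow_mul hn0.le]; norm_num
  have hyn : (n : ℝ) ^ (-(2 / 3) : ℝ) = 1 / y ^ 2 := by
    rw [hy, ← Real.rpow_natCast, ← Real.rpow_mul hn0.le, one_div, ← Real.rpow_neg hn0.le]; norm_num
  -- The window width `n^(1/3)` balances the mean squared bias, of order at most `N / n`, with the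
  -- variance, of order at most `N⁻²`.
  set N : ℕ := ⌈y⌉₊ with hN
  have hN0 : 0 < N := Nat.ceil_pos.2 hy0
  have hNy : y ≤ N := Nat.le_ceil y
  have hN2 : (N : ℝ) ≤ 2 * y := by
    have := Nat.ceil_lt_add_one hy0.le
    linarith
  have hNn : N ≤ n := by
    refine Nat.ceil_le.2 ?_
    rw [← hy3]
    exact le_self_pow₀ hy1 (by norm_num)
  refine (iInf₂_le (lowPass N) (isAdmissible_lowPass hN0)).trans (iSup₂_le fun f hf => ?_)
  refine (risk_le_of_localized hord hf σ (isAdmissible_lowPass hN0).hasSum_one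
    (summable_moment_lowPass hN0) (tsum_abs_lowPass_le hN0) (tsum_moment_lowPass_le hN0)
    (tsum_residue_lowPass_le hN0 hNn)).trans (ENNReal.ofReal_le_ofReal ?_)
  rw [hyn, ← hy3]
  have h1 : 5 * A * (2 * decayConst * residueBound ^ 2 * N) / y ^ 3 ≤ 20 * A ^ 2 * (1 / y ^ 2) := by
    calc 5 * A * (2 * decayConst * residueBound ^ 2 * N) / y ^ 3
        = 10 * A ^ 2 * N / y ^ 3 := by rw [hAdef]; ring
      _ ≤ 10 * A ^ 2 * (2 * y) / y ^ 3 := by gcongr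
      _ = _ := by field_simp; ring
  have h2 : (σ : ℝ) ^ 2 * (A / (N : ℝ) ^ 2 * A) ≤ σ ^ 2 * A ^ 2 * (1 / y ^ 2) := by
    calc (σ : ℝ) ^ 2 * (A / (N : ℝ) ^ 2 * A) = σ ^ 2 * A ^ 2 * (1 / (N : ℝ) ^ 2) := by ring
      _ ≤ _ := by gcongr
  calc _ ≤ 20 * A ^ 2 * (1 / y ^ 2) + σ ^ 2 * A ^ 2 * (1 / y ^ 2) := add_le_add h1 h2
    _ = _ := by ring

end HorizonFilter

end

theorem theorem2 (ord : ℝ → ℕ)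
    (hord : ord = (fun a : ℝ => ⌊a⌋₊) ∨ ord = (fun a : ℝ => ⌈a⌉₊ - 1))
    (α C : ℝ) (hα : 0 < α) (hC : 0 < C) (σ : ℝ≥0) (hσ : 0 < σ) :
    ∃ c₁ c₂ : ℝ, 0 < c₁ ∧ 0 < c₂ ∧ ∃ n₀ : ℕ, ∀ (n : ℕ) [NeZero n], n₀ < n →
      ENNReal.ofReal (c₁ * (n : ℝ) ^ (-(2 / 3) : ℝ)) ≤ HorizonFilter.minimaxRisk ord α C σ n ∧
      HorizonFilter.minimaxRisk ord α C σ n ≤ ENNReal.ofReal (c₂ * (n : ℝ) ^ (-(2 / 3) : ℝ)) := by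
  obtain ⟨c₁, hc₁, n₀, h₁⟩ := HorizonFilter.exists_minimaxRisk_ge hord hα hC hσ
  obtain ⟨c₂, hc₂, h₂⟩ := HorizonFilter.exists_minimaxRisk_le hord α C σ
  exact ⟨c₁, c₂, hc₁, hc₂, n₀, fun n _ hn => ⟨h₁ n hn, h₂ n⟩⟩
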